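/- **Setting.** There are $K\ge 1$ actions $A$, $T$ rounds and $T$ agents. In round $t$ the algorithm issues a recommendation $I_t\in A$ (a possibly random function of its past observations), a reward vector $u_t\in[0,1]^K$ is realized independently of $I_t$, the arriving agent plays some $a_t\in A$, and the algorithm observes $a_t$ and $u_{t,a_t}$. Agent $i$ holds (i) a reward belief $\mathcal P^i$, a distribution over sequences $\mu=(\mu_1,\dots,\mu_T)$ of mean vectors in $[0,1]^K$, such that given $\mu$ the $u_t$ are drawn independently over $t$ from laws on $[0,1]^K$ with means $\mu_t$; and (ii), independently of the rewards, a belief over arrival orders (permutations $\tau$ of $[T]$), whose marginal for her own arrival time $\tau_i$ is her temporal belief $\mathcal D^i$. A strategy is a map $\sigma_i:A\to A$ from recommendations to played actions; $\sigma^*$ is the compliant profile (all identity maps). The algorithm implements an *incentive-compatible Bayes $\epsilon$-Nash equilibrium* ($\epsilon$-BNE) if for every agent $i$, every $\sigma_i':A\to A$ and every $a\in A$ with $\Pr(I_{\tau_i}=a\mid\sigma^*)>0$, under agent $i$'s beliefs, $$\mathbb E[\mu_{\tau_i,a}\mid I_{\tau_i}=a,\sigma^*_{-i}]\ \ge\ \mathbb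 E[\mu_{\tau_i,\sigma_i'(a)}\mid I_{\tau_i}=a,\sigma^*_{-i}]-\epsilon_i .$$ **Assumptions with parameters $(\alpha,\Delta,\rho)$, $\alpha,\Delta>0$.** For every agent $i$: (1) for every $a\in A$, $\Pr_{\mu\sim\mathcal P^i}\big(\min_{b\ne a}\mathbb E_{t\sim\mathcal D^i}[\mu_{t,a}-\mu_{t,b}]\ge\Delta\big)\ge\alpha$ (an empty minimum is $+\infty$); (2) $\mathcal P^i$-almost surely $\|\mu_{t+1}-\mu_t\|_\infty\le\rho$ for all $t\in[T-1]$. **Algorithm.** Exp4.S with parameter $L$ (its policies being the $K$ constant ones) uses $\eta=\sqrt{\ln(KL)/(KL)}$ and $\gamma=1/(KL)$. It starts with $w_1(a)=1/K$. In round $t$ it recommends $I_t\sim w_t$, forms $\hat c_t(b)=\frac{1-u_{t,a_t}}{w_t(a_t)}\mathbf 1[b=a_t]$, and sets $$w_{t+1}(a)=(1-K\gamma)\frac{w_t(a)e^{-\eta\hat c_t(a)}}{\sum_b w_t(b)e^{-\eta\hat c_t(b)}}+\gamma .$$ **Theorem.** There is an absolute constant $C>0$ such that, with $$r_{K}(L):=C\sqrt{\frac{K\ln(KL)}{L}}+2\sqrt{\frac{2\ln(2K)}{L}}\;=\;\tilde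 O(L^{-1/2})\quad(K\text{ fixed}),$$ the following holds. 1. Let $K\ge1$, $1\le L\le T$, and let $U_L$ be the set of uniform distributions on the windows $\{s,\dots,s+L-1\}$, $s\in[T-L+1]$. Suppose that the beliefs of all $T$ agents satisfy (1) and (2) with parameters $(\alpha,\Delta,\rho)$, that $\mathcal D^i\in U_L$ for all $i$, and that $\Delta-r_K(L)-\rho(L-1)>0$ (otherwise the error term is read as $+\infty$). Then Exp4.S with parameter $L$ implements an incentive-compatible Bayes $\epsilon$-Nash equilibrium with $$\epsilon_i=\frac{\Big(r_K(L)+\frac{2\rho(L^2-1)}{3L}\Big)\big(\Delta-\rho(L-1)\big)}{\alpha\big(\Delta-r_K(L)-\rho(L-1)\big)}\qquad\text{for every agent } i.$$ 2. Let $K\ge 1$ and $\alpha,\Delta>0$ be fixed, let $L=L(T)\to\infty$ and $\rho=\rho(T)=o(1/L(T))$ as $T\to\infty$. Then $\Delta-r_K(L)-\rho(L-1)>0$ for all large $T$, and the error $\epsilon_i$ of part 1 tends to $0$. -/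

import Mathlib

open MeasureTheory ProbabilityTheory Filter
open scoped ENNReal

noncomputable section

namespace IncentivizedExploration

/-! ### Protocol -/

/-- What the algorithm sees of a round `(I_t, a_t, u_t(a_t))`: the recommendation it issued, the
action that was played, and the reward of the played action (bandit feedback). -/
abbrev Obs (K : ℕ) : Type := Fin K × Fin K × unitInterval

/-- One round `(I_t, a_t, u_t)` of a transcript: recommendation, played action, and the whole
reward vector in `[0,1]^K`. -/
abbrev Round (K : ℕ) : Type := Fin K × Fin K × (Fin K → unitInterval)

/-- A sequence of mean reward vectors `μ_{t,a} ∈ [0,1]`; rounds are numbered `0, …, T-1`. -/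
abbrev MeanSeq (K T : ℕ) : Type := Fin T → Fin K → unitInterval

/-- The part of a round that the algorithm observes. -/
def Round.obs {K : ℕ} (r : Round K) : Obs K := (r.1, r.2.1, r.2.2 r.2.1)

theorem Round.measurable_obs {K : ℕ} : Measurable (Round.obs (K := K)) := by
  have h : Measurable (fun p : Fin K × (Fin K → unitInterval) => p.2 p.1) :=
    measurable_from_prod_countable_right fun a => measurable_pi_apply a
  exact measurable_fst.prodMk
    ((measurable_fst.comp measurable_snd).prodMk (h.comp measurable_snd))

/-- A (randomised) recommendation algorithm for `K` actions: after `n` rounds it draws the next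
recommendation from a law that depends (measurably) on what it has observed so far. -/
structure Algorithm (K : ℕ) where
  policy : ∀ n : ℕ, Kernel (Fin n → Obs K) (Fin K)
  isMarkov : ∀ n, IsMarkovKernel (policy n)

/-! ### Beliefs -/

/-- The beliefs of one agent. -/
structure AgentBelief (K T : ℕ) where
  /-- the reward belief: a distribution over sequences of mean reward vectors -/
  prior : Measure (MeanSeq K T)
  isProb : IsProbabilityMeasure prior
  /-- the law of the reward vector of each round, given the sequence of means; rewards of
  different rounds are drawn independently given the means (see `transcriptLaw`) -/
  rewardLaw : Fin T → Kernel (MeanSeq K T) (Fin K → unitInterval)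
  isMarkov : ∀ t, IsMarkovKernel (rewardLaw t)
  /-- the reward of action `a` in round `t` has mean `μ_{t,a}` -/
  mean_reward : ∀ᵐ m ∂prior, ∀ t a, ∫ u, (u a : ℝ) ∂(rewardLaw t m) = (m t a : ℝ)
  /-- the full arrival belief: the permutation `τ` says that agent `j` arrives in round `τ j` -/
  arrival : PMF (Equiv.Perm (Fin T))

/-- The temporal belief of agent `i`: the marginal law of the arrival time `τ_i`. -/
def AgentBelief.temporal {K T : ℕ} (B : AgentBelief K T) (i : Fin T) : PMF (Fin T) :=
  B.arrival.map fun τ => τ i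

/-- `U_L`: the uniform distributions over the windows `{s, …, s+L-1}` contained in the horizon. -/
def uniformWindows (T L : ℕ) : Set (PMF (Fin T)) :=
  {D | ∃ s : ℕ, s + L ≤ T ∧
    ∀ t : Fin T, D t = if s ≤ (t : ℕ) ∧ (t : ℕ) < s + L then (L : ℝ≥0∞)⁻¹ else 0}

/-- `gap_{μ,D}(a) = min_{b ≠ a} E_{t ∼ D}[μ_{t,a} - μ_{t,b}]` (`+∞` if `a` is the only action). -/
def gap {K T : ℕ} (m : MeanSeq K T) (D : PMF (Fin T)) (a : Fin K) : EReal :=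
  ⨅ (b : Fin K) (_ : b ≠ a), ((∑ t, (D t).toReal * ((m t a : ℝ) - (m t b : ℝ)) : ℝ) : EReal)

/-- Every action beats all others by at least `Δ`, as averaged over the temporal belief `D`, with
prior probability at least `α`. -/
def AgentBelief.Explorable {K T : ℕ} (B : AgentBelief K T) (D : PMF (Fin T)) (α Δ : ℝ) : Prop :=
  ∀ a : Fin K, α ≤ B.prior.real {m | (Δ : EReal) ≤ gap m D a}

/-- The mean vectors move by at most `ρ` per round in sup norm, for (almost) every realization. -/
def AgentBelief.SlowlyMoving {K T : ℕ} (B : AgentBelief K T) (ρ : ℝ) : Prop :=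
  ∀ᵐ m ∂B.prior, ∀ (t : ℕ) (h : t + 1 < T),
    ‖fun a : Fin K => (m ⟨t + 1, h⟩ a : ℝ) - (m ⟨t, Nat.lt_of_succ_lt h⟩ a : ℝ)‖ ≤ ρ

/-! ### The recommendation game -/

/-- A strategy profile: each agent maps the recommendation she gets to the action she plays. -/
abbrev Profile (K T : ℕ) : Type := Fin T → Fin K → Fin K

/-- The compliant profile: every agent follows her recommendation. -/
def compliant (K T : ℕ) : Profile K T := fun _ a => a

/-- Given the means, the law of recommendation and reward vector in the next round `t`, when the
first `n` rounds were `h`: they are independent, the recommendation depends on the observed part of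
`h` only, and the rewards depend on the means only. -/
def stepLaw {K T : ℕ} (alg : Algorithm K) (B : AgentBelief K T) (n : ℕ) (t : Fin T) :
    Kernel (MeanSeq K T × (Fin n → Round K)) (Fin K × (Fin K → unitInterval)) :=
  ((alg.policy n).comap (fun p : MeanSeq K T × (Fin n → Round K) => fun j => (p.2 j).obs)
      (measurable_pi_lambda _ fun j =>
        Round.measurable_obs.comp ((measurable_pi_apply j).comp measurable_snd))) ×ₖ
    ((B.rewardLaw t).comap Prod.fst measurable_fst)

/-- Given the means, the law of the first `n` rounds of the transcript when rewards are as in the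
belief `B`, the agents play `σ`, and arrive in the order `τ` (the agent of round `t` is `τ⁻¹ t`). -/
def transcriptLaw {K T : ℕ} (alg : Algorithm K) (B : AgentBelief K T) (σ : Profile K T)
    (τ : Equiv.Perm (Fin T)) : (n : ℕ) → n ≤ T → Kernel (MeanSeq K T) (Fin n → Round K)
  | 0, _ => Kernel.const _ (Measure.dirac fun j => j.elim0)
  | n + 1, hn =>
      ((transcriptLaw alg B σ τ n (Nat.le_of_succ_le hn)) ⊗ₖ (stepLaw alg B n ⟨n, hn⟩)).map
        fun p : (Fin n → Round K) × (Fin K × (Fin K → unitInterval)) =>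
          Fin.snoc (α := fun _ => Round K) p.1 (p.2.1, σ (τ.symm ⟨n, hn⟩) p.2.1, p.2.2)

/-- The joint law, according to the belief `B` of agent `i` under the profile `σ`, of the means `μ`,
the arrival time `τ_i` and the transcript `Π_T`. Arrival times are independent of the means. -/
def gameLaw {K T : ℕ} (alg : Algorithm K) (B : AgentBelief K T) (σ : Profile K T) (i : Fin T) :
    Measure (MeanSeq K T × Fin T × (Fin T → Round K)) :=
  ∑ τ : Equiv.Perm (Fin T), B.arrival τ •
    (B.prior ⊗ₘ transcriptLaw alg B σ τ T le_rfl).map fun p => (p.1, τ i, p.2)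

/-- The event `I_{τ_i} = a`. -/
def recommended {K T : ℕ} (a : Fin K) : Set (MeanSeq K T × Fin T × (Fin T → Round K)) :=
  {ω | (ω.2.2 ω.2.1).1 = a}

/-- `U_i(σ | a) = E[μ_{τ_i, σ_i(I_{τ_i})} | I_{τ_i} = a]` under the profile `σ`. -/
def condPayoff {K T : ℕ} (alg : Algorithm K) (B : AgentBelief K T) (σ : Profile K T) (i : Fin T)
    (a : Fin K) : ℝ :=
  ∫ ω, (ω.1 ω.2.1 (σ i (ω.2.2 ω.2.1).1) : ℝ) ∂((gameLaw alg B σ i)[|recommended a])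

/-- `σ` is a Bayes `ε`-Nash equilibrium of the recommendation game, where agent `i` has beliefs
`B i` and error `ε i`: conditionally on any recommendation of positive probability, no unilateral
deviation gains more than `ε i` in expectation. -/
def IsApproxBNE {K T : ℕ} (alg : Algorithm K) (B : Fin T → AgentBelief K T) (ε : Fin T → ℝ)
    (σ : Profile K T) : Prop :=
  ∀ (i : Fin T) (σ' : Fin K → Fin K) (a : Fin K), gameLaw alg (B i) σ i (recommended a) ≠ 0 →
    condPayoff alg (B i) σ i a ≥ condPayoff alg (B i) (Function.update σ i σ') i a - ε i

/-- The algorithm implements an incentive-compatible Bayes `ε`-Nash equilibrium. -/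
def ImplementsICBNE {K T : ℕ} (alg : Algorithm K) (B : Fin T → AgentBelief K T)
    (ε : Fin T → ℝ) : Prop :=
  IsApproxBNE alg B ε (compliant K T)

/-! ### Exp4.S -/

/-- Learning rate of Exp4.S with parameter `L`. -/
def exp4sEta (K L : ℕ) : ℝ := √(Real.log (K * L) / (K * L))

/-- Sharing weight of Exp4.S with parameter `L`. -/
def exp4sGamma (K L : ℕ) : ℝ := 1 / (K * L)

/-- Importance-weighted loss estimate: action `b` gets `(1 - u_t(a_t)) / w_t(a_t)` if it is the
played action `a_t`, and `0` otherwise. -/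
def exp4sLoss {K : ℕ} (w : Fin K → ℝ) (o : Obs K) (b : Fin K) : ℝ :=
  if b = o.2.1 then (1 - (o.2.2 : ℝ)) / w b else 0

/-- Exponential update, before normalization. -/
def exp4sUpdate (K L : ℕ) (w : Fin K → ℝ) (o : Obs K) (b : Fin K) : ℝ :=
  w b * Real.exp (-(exp4sEta K L * exp4sLoss w o b))

/-- The probabilities with which Exp4.S (for the multi-armed bandit, where the policies are the `K`
actions) issues its recommendations after `n` rounds: start uniform, then after every round do a
normalized exponential update and mix with the uniform distribution. -/
def exp4sWeights (K L : ℕ) : (n : ℕ) → (Fin n → Obs K) → Fin K → ℝ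
  | 0, _, _ => 1 / K
  | n + 1, h, a =>
      let w := exp4sWeights K L n (Fin.init h)
      let o := h (Fin.last n)
      (1 - K * exp4sGamma K L) * (exp4sUpdate K L w o a / ∑ b, exp4sUpdate K L w o b)
        + exp4sGamma K L

theorem exp4sGamma_nonneg (K L : ℕ) : 0 ≤ exp4sGamma K L := by
  unfold exp4sGamma; positivity

theorem mul_exp4sGamma_le (K L : ℕ) : K * exp4sGamma K L ≤ 1 := by
  unfold exp4sGamma
  rcases Nat.eq_zero_or_pos K with rfl | hK
  · simp
  rcases Nat.eq_zero_or_pos L with rfl | hL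
  · simp
  have hK' : (0 : ℝ) < K := by exact_mod_cast hK
  have hL' : (1 : ℝ) ≤ L := by exact_mod_cast hL
  rw [mul_one_div, div_le_one (by positivity)]
  nlinarith

theorem exp4sWeights_spec (K L : ℕ) [NeZero K] (n : ℕ) (h : Fin n → Obs K) :
    (∀ a, 0 ≤ exp4sWeights K L n h a) ∧ ∑ a, exp4sWeights K L n h a = 1 := by
  have hK : (K : ℝ) ≠ 0 := NeZero.ne _
  induction n with
  | zero =>
    refine ⟨fun a => by simp [exp4sWeights], ?_⟩
    simp [exp4sWeights, hK]
  | succ n ih =>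
    obtain ⟨h0, h1⟩ := ih (Fin.init h)
    set w := exp4sWeights K L n (Fin.init h) with hw
    have hu : ∀ b, 0 ≤ exp4sUpdate K L w (h (Fin.last n)) b := fun b =>
      mul_nonneg (h0 b) (Real.exp_pos _).le
    have hZ : 0 < ∑ b, exp4sUpdate K L w (h (Fin.last n)) b := by
      obtain ⟨b, -, hb⟩ : ∃ b ∈ Finset.univ, 0 < w b := by
        by_contra! hcon
        have := Finset.sum_nonpos hcon
        linarith
      exact Finset.sum_pos' (fun b _ => hu b)
        ⟨b, Finset.mem_univ _, mul_pos hb (Real.exp_pos _)⟩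
    have hc : 0 ≤ 1 - K * exp4sGamma K L := sub_nonneg.2 (mul_exp4sGamma_le K L)
    constructor
    · intro a
      exact add_nonneg (mul_nonneg hc (div_nonneg (hu a) hZ.le)) (exp4sGamma_nonneg K L)
    · simp only [exp4sWeights, ← hw, Finset.sum_add_distrib, ← Finset.mul_sum, ← Finset.sum_div,
        div_self hZ.ne', Finset.sum_const, Finset.card_univ, Fintype.card_fin, nsmul_eq_mul]
      ring

theorem measurable_exp4sWeights (K L : ℕ) (n : ℕ) (a : Fin K) :
    Measurable fun h : Fin n → Obs K => exp4sWeights K L n h a := by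
  induction n generalizing a with
  | zero => simp only [exp4sWeights]; exact measurable_const
  | succ n ih =>
    have hi : Measurable fun h : Fin (n + 1) → Obs K => Fin.init h :=
      measurable_pi_lambda _ fun j => measurable_pi_apply _
    have hw : ∀ b, Measurable fun h : Fin (n + 1) → Obs K =>
        exp4sWeights K L n (Fin.init h) b := fun b => (ih b).comp hi
    have ho : Measurable fun h : Fin (n + 1) → Obs K => h (Fin.last n) := measurable_pi_apply _
    have hl : ∀ b, Measurable fun h : Fin (n + 1) → Obs K =>
        exp4sLoss (exp4sWeights K L n (Fin.init h)) (h (Fin.last n)) b := by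
      intro b
      unfold exp4sLoss
      refine Measurable.ite ?_ ?_ measurable_const
      · exact measurableSet_eq_fun measurable_const
          (measurable_fst.comp (measurable_snd.comp ho))
      · exact (measurable_const.sub (measurable_subtype_coe.comp
          (measurable_snd.comp (measurable_snd.comp ho)))).div (hw b)
    have hu : ∀ b, Measurable fun h : Fin (n + 1) → Obs K =>
        exp4sUpdate K L (exp4sWeights K L n (Fin.init h)) (h (Fin.last n)) b := fun b =>
      (hw b).mul (Real.measurable_exp.comp ((hl b).const_mul _).neg)
    simp only [exp4sWeights]
    exact (((hu a).div (Finset.measurable_fun_sum _ fun b _ => hu b)).const_mul _).add_const _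

/-- Exp4.S with parameter `L`, for `K` actions. -/
def exp4s (K L : ℕ) [NeZero K] : Algorithm K where
  policy n :=
    { toFun := fun h => ∑ a, ENNReal.ofReal (exp4sWeights K L n h a) • Measure.dirac a
      measurable' := by
        refine Measure.measurable_of_measurable_coe _ fun s _ => ?_
        simp only [Measure.coe_finsetSum, Finset.sum_apply, Measure.smul_apply, smul_eq_mul]
        exact Finset.measurable_fun_sum _ fun a _ =>
          (measurable_exp4sWeights K L n a).ennreal_ofReal.mul_const _ }
  isMarkov n := ⟨fun h => ⟨by
    change (∑ a, ENNReal.ofReal (exp4sWeights K L n h a) • Measure.dirac a) Set.univ = 1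
    simp only [Measure.coe_finsetSum, Finset.sum_apply, Measure.smul_apply, smul_eq_mul,
      measure_univ, mul_one]
    rw [← ENNReal.ofReal_sum_of_nonneg fun a _ => (exp4sWeights_spec K L n h).1 a,
      (exp4sWeights_spec K L n h).2, ENNReal.ofReal_one]⟩⟩

/-! ### The error term -/

/-- The `Õ(L^{-1/2})` term, with the constant `C` in front of the regret rate. -/
def rate (C : ℝ) (K L : ℕ) : ℝ :=
  C * √(K * Real.log (K * L) / L) + 2 * √(2 * Real.log (2 * K) / L)

/-- The part `Δ - Õ(L^{-1/2}) - ρ(L-1)` of the gap that is left after the error terms. -/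
def effectiveGap (C : ℝ) (K L : ℕ) (Δ ρ : ℝ) : ℝ := Δ - rate C K L - ρ * (L - 1)

/-- The error `ε_i`; meaningful only if the effective gap is positive. -/
def errorTerm (C : ℝ) (K L : ℕ) (α Δ ρ : ℝ) : ℝ :=
  ((rate C K L + 2 * ρ * ((L : ℝ) ^ 2 - 1) / (3 * L)) * (Δ - ρ * (L - 1))) /
    (α * effectiveGap C K L Δ ρ)

end IncentivizedExploration

end

/-! An agent's strategy acts only after her own recommendation, and the others comply, so given the
means `m` the law of the recommendation in round `t` is a fixed `recProb`, whatever she plays and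
whatever the arrival order. Hence the payoff given recommendation `a`, when `b` is played instead,
is the window average of `E[p_t(a) μ_{t,b}]` divided by that of `E[p_t(a)]`. The denominator does
not depend on `b`; the gain is bounded by an upper bound on the difference of numerators over a
lower bound on the denominator. Both come from the regret of Exp4.S over the window, pointwise in
the means.

Numerator (`sum_mul_sub_le_of_regret`): with slow drift no action ever beats the best fixed action
of the window by much, so after a small shift all terms of the regret are nonnegative and the share
of the single action `a` is at most the whole.

Denominator (`le_sum_of_regret_of_gap`): if `a` leads by `Δ` on average, it leads by `Δ - ρ(L-1)` in
each round, so small regret against `a` forces it to be recommended often. This event has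
probability at least `α`, and Markov's inequality concludes.

Regret (`exp4s_window_regret`): the potential is the expected logarithm of the weight of the
comparator. Its increment is at least `η` times the instantaneous regret minus second-order terms.
Mixing keeps each weight above `1/(KL)`, so the potential stays in `[-log(KL), 0]` and the
increments telescope over a window with any starting point. -/

noncomputable section

namespace IncentivizedExploration

/-! ### Slowly moving means over a window -/

theorem sum_range_abs_last_sub (L : ℕ) :
    ∑ k ∈ Finset.range L, |(L : ℝ) - k| = (L : ℝ) * (L + 1) / 2 := by
  have h : ∀ k ∈ Finset.range L, |(L : ℝ) - k| = (L : ℝ) - k := fun k hk =>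
    abs_of_nonneg (sub_nonneg.2 (by exact_mod_cast (Finset.mem_range.1 hk).le))
  have hg : ∀ n : ℕ, ∑ k ∈ Finset.range n, (k : ℝ) = (n : ℝ) * (n - 1) / 2 := by
    intro n
    induction n with
    | zero => simp
    | succ n ih => rw [Finset.sum_range_succ, ih]; push_cast; ring
  rw [Finset.sum_congr rfl h, Finset.sum_sub_distrib, hg]
  simp only [Finset.sum_const, Finset.card_range, nsmul_eq_mul]
  ring

/-- The endpoints are the worst case. In the induction a new point adds at most `L`, exactly the
growth of the bound. Doubled and divided by `L`, this becomes the loss `ρ(L-1)` in the gap. -/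
theorem sum_range_abs_sub_le (L j : ℕ) (hj : j < L) :
    ∑ k ∈ Finset.range L, |(j : ℝ) - k| ≤ (L : ℝ) * (L - 1) / 2 := by
  induction L with
  | zero => omega
  | succ L ih =>
    rw [Finset.sum_range_succ]
    rcases Nat.lt_succ_iff_lt_or_eq.1 hj with h | rfl
    · have h1 : |(j : ℝ) - L| ≤ L := by
        rw [abs_sub_comm, abs_of_nonneg (sub_nonneg.2 (by exact_mod_cast h.le))]
        linarith [Nat.cast_nonneg (α := ℝ) j]
      have := ih h
      push_cast
      nlinarith
    · rw [sum_range_abs_last_sub]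
      simp
      linarith

/-- The source of the drift term `2ρ(L²-1)/(3L)`: there the deviation is summed over all rounds, so
the exact value is used instead of the worst round. -/
theorem sum_sum_range_abs_sub (L : ℕ) :
    ∑ j ∈ Finset.range L, ∑ k ∈ Finset.range L, |(j : ℝ) - k| = ((L : ℝ) ^ 3 - L) / 3 := by
  induction L with
  | zero => simp
  | succ L ih =>
    have h2 : ∑ j ∈ Finset.range L, |(j : ℝ) - L| = (L : ℝ) * (L + 1) / 2 := by
      rw [← sum_range_abs_last_sub]
      exact Finset.sum_congr rfl fun k _ => abs_sub_comm _ _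
    simp only [Finset.sum_range_succ, Finset.sum_add_distrib, ih, h2, sum_range_abs_last_sub,
      sub_self, abs_zero]
    push_cast
    ring

theorem sum_abs_sub_le {L : ℕ} (j : Fin L) :
    ∑ k : Fin L, |((j : ℕ) : ℝ) - (k : ℕ)| ≤ (L : ℝ) * (L - 1) / 2 := by
  rw [Fin.sum_univ_eq_sum_range (fun k => |((j : ℕ) : ℝ) - (k : ℝ)|) L]
  exact sum_range_abs_sub_le L j j.2

theorem sum_sum_abs_sub (L : ℕ) :
    ∑ j : Fin L, ∑ k : Fin L, |((j : ℕ) : ℝ) - (k : ℕ)| = ((L : ℝ) ^ 3 - L) / 3 := by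
  rw [← sum_sum_range_abs_sub,
    ← Fin.sum_univ_eq_sum_range (fun j => ∑ k ∈ Finset.range L, |(j : ℝ) - (k : ℝ)|) L]
  exact Finset.sum_congr rfl fun j _ =>
    Fin.sum_univ_eq_sum_range (fun k => |((j : ℕ) : ℝ) - (k : ℝ)|) L

/-- Distance of a slowly moving sequence from its average, up to the factor `L`. -/
theorem abs_mul_sub_sum_le {L : ℕ} {ρ : ℝ} {x : Fin L → ℝ}
    (hx : ∀ j k, |x j - x k| ≤ ρ * |((j : ℕ) : ℝ) - (k : ℕ)|) (j : Fin L) :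
    |L * x j - ∑ k, x k| ≤ ρ * ∑ k : Fin L, |((j : ℕ) : ℝ) - (k : ℕ)| := by
  have h : L * x j - ∑ k, x k = ∑ k, (x j - x k) := by simp
  rw [h, Finset.mul_sum]
  exact (Finset.abs_sum_le_sum_abs _ _).trans (Finset.sum_le_sum fun k _ => hx j k)

/-- Small regret against every fixed action and slow drift bound the gain from replacing a
recommended action `a` by any `b`. -/
theorem sum_mul_sub_le_of_regret {K L : ℕ} (hL : 1 ≤ L) {ρ r : ℝ} {x p : Fin L → Fin K → ℝ}
    (hx : ∀ a j k, |x j a - x k a| ≤ ρ * |((j : ℕ) : ℝ) - (k : ℕ)|)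
    (hp : ∀ j a, 0 ≤ p j a) (hp1 : ∀ j, ∑ a, p j a = 1)
    (hr : ∀ b, ∑ j, ∑ a, p j a * (x j b - x j a) ≤ L * r) (a b : Fin K) :
    ∑ j, p j a * (x j b - x j a) ≤ L * (r + 2 * ρ * ((L : ℝ) ^ 2 - 1) / (3 * L)) := by
  have hL0 : (0 : ℝ) < L := by exact_mod_cast hL
  -- `c` is the best fixed action in hindsight. Two actions are each compared with their window
  -- sums, and the sum of `c` is the larger, so no action exceeds `c` in round `j` by more than `2 *
  -- d j / L`.
  obtain ⟨c, -, hc⟩ := Finset.exists_max_image Finset.univ (fun b => ∑ j, x j b) ⟨a, by simp⟩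
  set d : Fin L → ℝ := fun j => ρ * ∑ k : Fin L, |((j : ℕ) : ℝ) - (k : ℕ)| with hd
  have hdev : ∀ j e, L * (x j e - x j c) ≤ 2 * d j := by
    intro j e
    have h1 := abs_le.1 (abs_mul_sub_sum_le (hx e) j)
    have h2 := abs_le.1 (abs_mul_sub_sum_le (hx c) j)
    have h3 := hc e (Finset.mem_univ _)
    linarith [h1.2, h2.1]
  -- Adding `2 * d j` makes every summand of the regret against `c` nonnegative, so one summand is
  -- at most the sum. The same shift pays for replacing `b` by `c`, and it is counted once because
  -- the probabilities sum to one.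
  have hround : ∀ j, L * (p j a * (x j b - x j a)) ≤
      L * ∑ e, p j e * (x j c - x j e) + 2 * d j := by
    intro j
    have h1 : ∑ e, p j e * (L * (x j c - x j e) + 2 * d j)
        = L * ∑ e, p j e * (x j c - x j e) + 2 * d j := by
      simp only [mul_add, Finset.sum_add_distrib, ← Finset.sum_mul, hp1, Finset.mul_sum]
      rw [one_mul]
      congr 1
      exact Finset.sum_congr rfl fun e _ => by ring
    rw [← h1]
    have h2 : p j a * (L * (x j c - x j a) + 2 * d j) ≤
        ∑ e, p j e * (L * (x j c - x j e) + 2 * d j) :=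
      Finset.single_le_sum (f := fun e => p j e * (L * (x j c - x j e) + 2 * d j))
        (fun e _ => mul_nonneg (hp j e) (by linarith [hdev j e])) (Finset.mem_univ a)
    refine le_trans ?_ h2
    have := mul_le_mul_of_nonneg_left (hdev j b) (hp j a)
    nlinarith
  have hsum : ∑ j, d j = ρ * (((L : ℝ) ^ 3 - L) / 3) := by
    rw [hd, ← Finset.mul_sum, sum_sum_abs_sub]
  have h := Finset.sum_le_sum fun j (_ : j ∈ Finset.univ) => hround j
  rw [Finset.sum_add_distrib, ← Finset.mul_sum, ← Finset.mul_sum, ← Finset.mul_sum, hsum] at h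
  have h4 := mul_le_mul_of_nonneg_left (hr c) hL0.le
  have h5 : L * (L * (r + 2 * ρ * ((L : ℝ) ^ 2 - 1) / (3 * L))) =
      L * (L * r) + 2 * (ρ * (((L : ℝ) ^ 3 - L) / 3)) := by
    field_simp
  exact le_of_mul_le_mul_left (by linarith) hL0

/-- An action that beats all others by `Δ` on average is chosen often by an algorithm with small
regret. -/
theorem le_sum_of_regret_of_gap {K L : ℕ} (hL : 1 ≤ L) {ρ r Δ : ℝ} (hρ : 0 ≤ ρ * (L - 1))
    {x p : Fin L → Fin K → ℝ}
    (hx : ∀ a j k, |x j a - x k a| ≤ ρ * |((j : ℕ) : ℝ) - (k : ℕ)|)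
    (hp : ∀ j a, 0 ≤ p j a) (hp1 : ∀ j, ∑ a, p j a = 1) (a : Fin K)
    (hr : ∑ j, ∑ b, p j b * (x j a - x j b) ≤ L * r)
    (hΔ : ∀ b, b ≠ a → L * Δ ≤ ∑ j, (x j a - x j b)) (hpos : 0 < Δ - ρ * (L - 1)) :
    L * ((Δ - r - ρ * (L - 1)) / (Δ - ρ * (L - 1))) ≤ ∑ j, p j a := by
  have hL0 : (0 : ℝ) < L := by exact_mod_cast hL
  have hd : ∀ j : Fin L, 2 * (ρ * ∑ k : Fin L, |((j : ℕ) : ℝ) - (k : ℕ)|) ≤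
      L * (ρ * (L - 1)) := by
    intro j
    -- For `L = 1` the sign of `ρ` is unknown, but all distances vanish.
    rcases hL.eq_or_lt with h | h
    · subst h
      simp [Subsingleton.elim j 0]
    · have hL1 : (0 : ℝ) < L - 1 := by
        have : (1 : ℝ) < L := by exact_mod_cast h
        linarith
      have hρ0 : 0 ≤ ρ := nonneg_of_mul_nonneg_left hρ hL1
      have := mul_le_mul_of_nonneg_left (sum_abs_sub_le j) hρ0
      linarith
  have hgap : ∀ j b, b ≠ a → Δ - ρ * (L - 1) ≤ x j a - x j b := by
    intro j b hb
    have h1 := abs_le.1 (abs_mul_sub_sum_le (hx a) j)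
    have h2 := abs_le.1 (abs_mul_sub_sum_le (hx b) j)
    have h3 := hΔ b hb
    rw [Finset.sum_sub_distrib] at h3
    have h4 := hd j
    refine le_of_mul_le_mul_left ?_ hL0
    linarith [h1.1, h2.2]
  -- Each recommendation other than `a` costs at least the pointwise gap.
  have hround : ∀ j, (Δ - ρ * (L - 1)) * (1 - p j a) ≤ ∑ b, p j b * (x j a - x j b) := by
    intro j
    have h1 : (Δ - ρ * (L - 1)) * (1 - p j a) =
        ∑ b, if b = a then 0 else p j b * (Δ - ρ * (L - 1)) := by
      have h2 : ∑ b, (if b = a then 0 else p j b * (Δ - ρ * (L - 1))) =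
          ∑ b, (p j b * (Δ - ρ * (L - 1)) - if b = a then p j b * (Δ - ρ * (L - 1)) else 0) :=
        Finset.sum_congr rfl fun b _ => by split_ifs <;> simp
      rw [h2, Finset.sum_sub_distrib, ← Finset.sum_mul, hp1, Finset.sum_ite_eq' Finset.univ a]
      simp
      ring
    rw [h1]
    refine Finset.sum_le_sum fun b _ => ?_
    split_ifs with h
    · simp [h]
    · exact mul_le_mul_of_nonneg_left (hgap j b h) (hp j b)
  have h := (Finset.sum_le_sum fun j (_ : j ∈ Finset.univ) => hround j).trans hr
  rw [← Finset.mul_sum, Finset.sum_sub_distrib] at h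
  simp only [Finset.sum_const, Finset.card_univ, Fintype.card_fin, nsmul_eq_mul, mul_one] at h
  rw [mul_div_assoc', div_le_iff₀ hpos]
  linarith

/-! ### The law of the transcript -/

section Transcript

variable {K T : ℕ} (alg : Algorithm K) (B : AgentBelief K T)

instance (n : ℕ) : IsMarkovKernel (alg.policy n) := alg.isMarkov n

instance (t : Fin T) : IsMarkovKernel (B.rewardLaw t) := B.isMarkov t

instance : IsProbabilityMeasure B.prior := B.isProb

instance (n : ℕ) (t : Fin T) : IsMarkovKernel (stepLaw alg B n t) := by
  unfold stepLaw; infer_instance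

/-- The transcript of `n + 1` rounds from the first `n` rounds, the next recommendation and the next
reward vector, when the next agent plays `s`. -/
def appendRound {n : ℕ} (s : Fin K → Fin K)
    (p : (Fin n → Round K) × (Fin K × (Fin K → unitInterval))) : Fin (n + 1) → Round K :=
  Fin.snoc (α := fun _ => Round K) p.1 (p.2.1, s p.2.1, p.2.2)

theorem measurable_appendRound {n : ℕ} (s : Fin K → Fin K) :
    Measurable (appendRound (n := n) s) := by
  refine measurable_pi_lambda _ fun j => ?_
  refine Fin.lastCases ?_ (fun j => ?_) j
  · simp only [appendRound, Fin.snoc_last]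
    exact (measurable_fst.comp measurable_snd).prodMk
      (((measurable_of_countable s).comp (measurable_fst.comp measurable_snd)).prodMk
        (measurable_snd.comp measurable_snd))
  · simp only [appendRound, Fin.snoc_castSucc]
    exact (measurable_pi_apply j).comp measurable_fst

theorem transcriptLaw_succ (σ : Profile K T) (τ : Equiv.Perm (Fin T)) (n : ℕ) (hn : n + 1 ≤ T) :
    transcriptLaw alg B σ τ (n + 1) hn =
      ((transcriptLaw alg B σ τ n (Nat.le_of_succ_le hn)) ⊗ₖ (stepLaw alg B n ⟨n, hn⟩)).map
        (appendRound (σ (τ.symm ⟨n, hn⟩))) := rfl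

instance isMarkovKernel_transcriptLaw (σ : Profile K T) (τ : Equiv.Perm (Fin T)) (n : ℕ)
    (hn : n ≤ T) : IsMarkovKernel (transcriptLaw alg B σ τ n hn) := by
  induction n with
  | zero =>
    rw [transcriptLaw]
    infer_instance
  | succ n ih =>
    have := ih (Nat.le_of_succ_le hn)
    rw [transcriptLaw_succ]
    exact Kernel.IsMarkovKernel.map _ (measurable_appendRound _)

theorem integral_transcriptLaw_succ (σ : Profile K T) (τ : Equiv.Perm (Fin T)) (n : ℕ)
    (hn : n + 1 ≤ T) (m : MeanSeq K T) {f : (Fin (n + 1) → Round K) → ℝ} (hf : Measurable f)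
    {c : ℝ} (hc : ∀ h, |f h| ≤ c) :
    ∫ h, f h ∂(transcriptLaw alg B σ τ (n + 1) hn m) =
      ∫ h, ∫ p, f (appendRound (σ (τ.symm ⟨n, hn⟩)) (h, p)) ∂(stepLaw alg B n ⟨n, hn⟩ (m, h))
        ∂(transcriptLaw alg B σ τ n (Nat.le_of_succ_le hn) m) := by
  have hm := measurable_appendRound (n := n) (σ (τ.symm ⟨n, hn⟩))
  rw [transcriptLaw_succ, Kernel.map_apply _ hm,
    integral_map hm.aemeasurable hf.aestronglyMeasurable, integral_compProd]
  exact Integrable.of_bound (hf.comp hm).aestronglyMeasurable c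
    (ae_of_all _ fun _ => hc _)

theorem transcriptLaw_castSucc (σ : Profile K T) (τ : Equiv.Perm (Fin T)) (n : ℕ)
    (hn : n + 1 ≤ T) (m : MeanSeq K T) (j : Fin n) (a : Fin K) :
    transcriptLaw alg B σ τ (n + 1) hn m {h | (h j.castSucc).1 = a} =
      transcriptLaw alg B σ τ n (Nat.le_of_succ_le hn) m {h | (h j).1 = a} := by
  have hS : ∀ (k : ℕ) (j : Fin k), MeasurableSet {h : Fin k → Round K | (h j).1 = a} :=
    fun k j => measurableSet_eq_fun (measurable_fst.comp (measurable_pi_apply j)) measurable_const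
  have hm := measurable_appendRound (n := n) (σ (τ.symm ⟨n, hn⟩))
  rw [transcriptLaw_succ, Kernel.map_apply' _ hm _ (hS _ _), Kernel.compProd_apply (hm (hS _ _)),
    ← lintegral_indicator_one (hS n j)]
  refine lintegral_congr fun h => ?_
  by_cases hh : (h j).1 = a <;> simp [appendRound, hh]

theorem transcriptLaw_last (σ : Profile K T) (τ : Equiv.Perm (Fin T)) (n : ℕ)
    (hn : n + 1 ≤ T) (m : MeanSeq K T) (a : Fin K) :
    transcriptLaw alg B σ τ (n + 1) hn m {h | (h (Fin.last n)).1 = a} =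
      ∫⁻ h, alg.policy n (fun j => (h j).obs) {a}
        ∂(transcriptLaw alg B σ τ n (Nat.le_of_succ_le hn) m) := by
  have hS : MeasurableSet {h : Fin (n + 1) → Round K | (h (Fin.last n)).1 = a} :=
    measurableSet_eq_fun (measurable_fst.comp (measurable_pi_apply _)) measurable_const
  have hm := measurable_appendRound (n := n) (σ (τ.symm ⟨n, hn⟩))
  rw [transcriptLaw_succ, Kernel.map_apply' _ hm _ hS, Kernel.compProd_apply (hm hS)]
  refine lintegral_congr fun h => ?_
  have h1 : Prod.mk h ⁻¹' (appendRound (σ (τ.symm ⟨n, hn⟩)) ⁻¹'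
      {h | (h (Fin.last n)).1 = a}) = {a} ×ˢ Set.univ := by
    ext p
    simp [appendRound]
  rw [h1, stepLaw, Kernel.prod_apply, Measure.prod_prod, measure_univ, mul_one, Kernel.comap_apply]

/-- Later rounds are added by Markov kernels and integrate out, so only the law of the `t` earlier
rounds matters. -/
theorem transcriptLaw_of_lt (σ : Profile K T) (τ : Equiv.Perm (Fin T)) (m : MeanSeq K T)
    (a : Fin K) (t n : ℕ) (ht : t < n) (hn : n ≤ T) :
    transcriptLaw alg B σ τ n hn m {h | (h ⟨t, ht⟩).1 = a} =
      ∫⁻ h, alg.policy t (fun j => (h j).obs) {a}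
        ∂(transcriptLaw alg B σ τ t (ht.le.trans hn) m) := by
  induction n with
  | zero => omega
  | succ n ih =>
    rcases Nat.lt_succ_iff_lt_or_eq.1 ht with h | rfl
    · rw [← ih h (Nat.le_of_succ_le hn)]
      exact transcriptLaw_castSucc alg B σ τ n hn m ⟨t, h⟩ a
    · exact transcriptLaw_last alg B σ τ t hn m a

/-- The transcript up to the arrival of agent `i` does not depend on the strategy of `i` nor, if
everybody else is compliant, on the order of arrival. -/
theorem transcriptLaw_update_eq (i : Fin T) (s : Fin K → Fin K) (τ τ' : Equiv.Perm (Fin T)) (n : ℕ)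
    (hn : n ≤ T) (hi : n ≤ τ i) :
    transcriptLaw alg B (Function.update (compliant K T) i s) τ n hn =
      transcriptLaw alg B (compliant K T) τ' n hn := by
  induction n with
  | zero => rfl
  | succ n ih =>
    rw [transcriptLaw_succ, transcriptLaw_succ, ih _ (Nat.le_of_succ_le hi),
      Function.update_of_ne]
    · rfl
    · intro h
      have h1 : τ i = ⟨n, hn⟩ := by rw [← h]; simp
      have h2 : (τ i : ℕ) = n := by rw [h1]
      omega

/-- The probability, given the means, that action `a` is recommended in round `t` if all agents are
compliant. -/
def recProb (t : Fin T) (m : MeanSeq K T) (a : Fin K) : ℝ :=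
  (transcriptLaw alg B (compliant K T) 1 T le_rfl m).real {h | (h t).1 = a}

theorem recProb_nonneg (t : Fin T) (m : MeanSeq K T) (a : Fin K) : 0 ≤ recProb alg B t m a :=
  measureReal_nonneg

theorem recProb_le_one (t : Fin T) (m : MeanSeq K T) (a : Fin K) : recProb alg B t m a ≤ 1 :=
  measureReal_le_one

theorem measurable_recProb (t : Fin T) (a : Fin K) : Measurable fun m => recProb alg B t m a :=
  (Kernel.measurable_coe _ (measurableSet_eq_fun
    (measurable_fst.comp (measurable_pi_apply t)) measurable_const)).ennreal_toReal

theorem recProb_eq_integral (t : Fin T) (m : MeanSeq K T) (a : Fin K) :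
    recProb alg B t m a = ∫ h, (alg.policy t (fun j => (h j).obs)).real {a}
      ∂(transcriptLaw alg B (compliant K T) 1 t t.2.le m) := by
  rw [recProb, measureReal_def, transcriptLaw_of_lt alg B _ _ m a t T t.2 le_rfl]
  refine (integral_toReal ?_ (ae_of_all _ fun _ => measure_lt_top _ _)).symm
  exact ((Kernel.measurable_coe _ (measurableSet_singleton a)).comp (measurable_pi_lambda _
    fun j => Round.measurable_obs.comp (measurable_pi_apply j))).aemeasurable

/-- Justifies the arbitrary order `1` in `recProb`: before agent `i` arrives only compliant agents
have played, so neither the order nor her strategy `s` has left a trace. -/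
theorem transcriptLaw_update_real (i : Fin T) (s : Fin K → Fin K) (τ : Equiv.Perm (Fin T))
    (m : MeanSeq K T) (a : Fin K) :
    (transcriptLaw alg B (Function.update (compliant K T) i s) τ T le_rfl m).real
      {h | (h (τ i)).1 = a} = recProb alg B (τ i) m a := by
  rw [recProb, measureReal_def, measureReal_def,
    transcriptLaw_of_lt alg B _ _ m a (τ i) T (τ i).2 le_rfl,
    transcriptLaw_of_lt alg B _ _ m a (τ i) T (τ i).2 le_rfl,
    transcriptLaw_update_eq alg B i s τ 1 (τ i) (τ i).2.le le_rfl]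

theorem sum_recProb (t : Fin T) (m : MeanSeq K T) : ∑ a, recProb alg B t m a = 1 := by
  have h := sum_measureReal_preimage_singleton
    (μ := transcriptLaw alg B (compliant K T) 1 T le_rfl m) (Finset.univ : Finset (Fin K))
    (f := fun h => (h t).1) (fun a _ => (measurable_fst.comp (measurable_pi_apply t))
      (measurableSet_singleton a))
  exact h.trans (by simp)

end Transcript

/-! ### One round of Exp4.S -/

/-- Follows from `exp (-y) ≤ 1 / (1 + y)` and `(1 - y + y²)(1 + y) = 1 + y³`. No upper bound on `y`
is needed, which matters because importance-weighted losses can be large. -/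
theorem exp_neg_le_one_sub_add_sq {y : ℝ} (hy : 0 ≤ y) : Real.exp (-y) ≤ 1 - y + y ^ 2 := by
  rw [Real.exp_neg]
  have h1 : 1 + y ≤ Real.exp y := by linarith [Real.add_one_le_exp y]
  refine (inv_anti₀ (by linarith) h1).trans ?_
  rw [inv_le_iff_one_le_mul₀ (by linarith)]
  nlinarith [pow_nonneg hy 3]

theorem exp4sGamma_pos {K L : ℕ} (hK : 1 ≤ K) (hL : 1 ≤ L) : 0 < exp4sGamma K L := by
  unfold exp4sGamma
  have : (0 : ℝ) < K := by exact_mod_cast hK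
  have : (0 : ℝ) < L := by exact_mod_cast hL
  positivity

/-- The floor provided by mixing: no action is ever written off, so a window may start at any round.
-/
theorem exp4sGamma_le_exp4sWeights (K L : ℕ) [NeZero K] (hL : 1 ≤ L) (n : ℕ)
    (h : Fin n → Obs K) (a : Fin K) : exp4sGamma K L ≤ exp4sWeights K L n h a := by
  have hK : (0 : ℝ) < K := by exact_mod_cast Nat.pos_of_ne_zero (NeZero.ne K)
  have hL' : (1 : ℝ) ≤ L := by exact_mod_cast hL
  cases n with
  | zero =>
    simp only [exp4sWeights, exp4sGamma]
    exact one_div_le_one_div_of_le hK (le_mul_of_one_le_right hK.le hL')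
  | succ n =>
    simp only [exp4sWeights]
    have hw := (exp4sWeights_spec K L n (Fin.init h)).1
    have hu : ∀ b, 0 ≤ exp4sUpdate K L (exp4sWeights K L n (Fin.init h)) (h (Fin.last n)) b :=
      fun b => mul_nonneg (hw b) (Real.exp_pos _).le
    have := mul_nonneg (sub_nonneg.2 (mul_exp4sGamma_le K L))
      (div_nonneg (hu a) (Finset.sum_nonneg (s := Finset.univ) fun b _ => hu b))
    linarith

theorem exp4sWeights_le_one (K L : ℕ) [NeZero K] (n : ℕ) (h : Fin n → Obs K) (a : Fin K) :
    exp4sWeights K L n h a ≤ 1 := by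
  have hw := exp4sWeights_spec K L n h
  rw [← hw.2]
  exact Finset.single_le_sum (fun b _ => hw.1 b) (Finset.mem_univ a)

/-- The normalizing constant of the exponential update when the recommendation `i` is followed. -/
theorem sum_exp4sUpdate_le {K L : ℕ} {w : Fin K → ℝ} (hw : ∀ a, 0 < w a) (hw1 : ∑ a, w a = 1)
    (i : Fin K) (x : unitInterval) :
    ∑ b, exp4sUpdate K L w (i, i, x) b ≤
      1 - exp4sEta K L * (1 - x) + exp4sEta K L ^ 2 / w i := by
  have hη : 0 ≤ exp4sEta K L := Real.sqrt_nonneg _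
  have hx0 : 0 ≤ 1 - (x : ℝ) := sub_nonneg.2 x.2.2
  have hx1 : 1 - (x : ℝ) ≤ 1 := by linarith [x.2.1]
  set y := exp4sEta K L * ((1 - (x : ℝ)) / w i) with hy
  have hy0 : 0 ≤ y := mul_nonneg hη (div_nonneg hx0 (hw i).le)
  -- Only the played action has a nonzero loss estimate, so the total changes in one coordinate; the
  -- factor `w i` then cancels the importance weight in the linear term.
  have h1 : ∀ b, exp4sUpdate K L w (i, i, x) b =
      w b + if b = i then w i * (Real.exp (-y) - 1) else 0 := by
    intro b
    unfold exp4sUpdate exp4sLoss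
    by_cases hb : b = i
    · subst hb
      simp only [if_true, ← hy]
      ring
    · simp [hb]
  rw [Finset.sum_congr rfl fun b _ => h1 b, Finset.sum_add_distrib, hw1,
    Finset.sum_ite_eq' Finset.univ i]
  simp only [Finset.mem_univ, if_true]
  have h2 := mul_le_mul_of_nonneg_left (exp_neg_le_one_sub_add_sq hy0) (hw i).le
  have h3 : w i * y = exp4sEta K L * (1 - x) := by
    rw [hy]
    field_simp [(hw i).ne']
  have h4 : w i * y ^ 2 ≤ exp4sEta K L ^ 2 / w i := by
    have : w i * y ^ 2 = exp4sEta K L ^ 2 / w i * (1 - (x : ℝ)) ^ 2 := by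
      rw [hy]
      field_simp [(hw i).ne']
    rw [this]
    refine mul_le_of_le_one_right (div_nonneg (sq_nonneg _) (hw i).le) ?_
    exact pow_le_one₀ hx0 hx1
  nlinarith

/-- The log-weight of a fixed action after one round in which the recommendation `i` is
followed. -/
theorem log_exp4s_step {K L : ℕ} (hK : K * exp4sGamma K L < 1) {w : Fin K → ℝ}
    (hw : ∀ a, 0 < w a) (hw1 : ∑ a, w a = 1) (i b : Fin K) (x : unitInterval) :
    Real.log (1 - K * exp4sGamma K L) + Real.log (w b)
        - exp4sEta K L * (if b = i then (1 - (x : ℝ)) / w i else 0)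
        + exp4sEta K L * (1 - x) - exp4sEta K L ^ 2 / w i ≤
      Real.log ((1 - K * exp4sGamma K L) *
        (exp4sUpdate K L w (i, i, x) b / ∑ e, exp4sUpdate K L w (i, i, x) e)
          + exp4sGamma K L) := by
  have hu : ∀ e, 0 < exp4sUpdate K L w (i, i, x) e := fun e => mul_pos (hw e) (Real.exp_pos _)
  have hZ : 0 < ∑ e, exp4sUpdate K L w (i, i, x) e :=
    Finset.sum_pos (fun e _ => hu e) ⟨i, Finset.mem_univ _⟩
  have hc : 0 < 1 - K * exp4sGamma K L := sub_pos.2 hK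
  -- The added `γ` is dropped here; below, `log Z ≤ Z - 1` handles the normalization.
  refine le_trans ?_ (Real.log_le_log (mul_pos hc (div_pos (hu b) hZ))
    (le_add_of_nonneg_right (exp4sGamma_nonneg K L)))
  rw [Real.log_mul hc.ne' (div_pos (hu b) hZ).ne', Real.log_div (hu b).ne' hZ.ne']
  have h1 : Real.log (exp4sUpdate K L w (i, i, x) b) = Real.log (w b)
      - exp4sEta K L * (if b = i then (1 - (x : ℝ)) / w i else 0) := by
    unfold exp4sUpdate exp4sLoss
    rw [Real.log_mul (hw b).ne' (Real.exp_pos _).ne', Real.log_exp]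
    by_cases hb : b = i
    · subst hb; simp; ring
    · simp [hb]
  rw [h1]
  linarith [Real.log_le_sub_one_of_pos hZ, sum_exp4sUpdate_le (L := L) hw hw1 i x]

/-! ### Regret of Exp4.S over a window -/

theorem exp4s_policy_real (K L : ℕ) [NeZero K] (n : ℕ) (h : Fin n → Obs K) (a : Fin K) :
    ((exp4s K L).policy n h).real {a} = exp4sWeights K L n h a := by
  have h1 : (exp4s K L).policy n h =
    ∑ a, ENNReal.ofReal (exp4sWeights K L n h a) • Measure.dirac a := rfl
  rw [measureReal_def, h1]
  simp only [Measure.coe_finsetSum, Finset.sum_apply, Measure.smul_apply, smul_eq_mul,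
    Measure.dirac_apply, Set.indicator_apply, Set.mem_singleton_iff, Pi.one_apply]
  simp [ENNReal.toReal_ofReal ((exp4sWeights_spec K L n h).1 a)]

theorem integral_stepLaw {K T : ℕ} (alg : Algorithm K) (B : AgentBelief K T) (n : ℕ) (t : Fin T)
    (m : MeanSeq K T) (h : Fin n → Round K) {f : Fin K × (Fin K → unitInterval) → ℝ}
    (hf : Measurable f) {c : ℝ} (hc : ∀ p, |f p| ≤ c) :
    ∫ p, f p ∂(stepLaw alg B n t (m, h)) =
      ∑ a, (alg.policy n (fun j => (h j).obs)).real {a} * ∫ u, f (a, u) ∂(B.rewardLaw t m) := by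
  rw [stepLaw, Kernel.prod_apply, Kernel.comap_apply, Kernel.comap_apply, integral_prod,
    integral_fintype .of_finite]
  · rfl
  · exact Integrable.of_bound hf.aestronglyMeasurable c (ae_of_all _ fun _ => hc _)

/-! ### The expected log-weight as a potential. -/

section LogWeight

variable {K L T : ℕ}

theorem exp4sWeights_appendRound (n : ℕ) (h : Fin n → Round K) (s : Fin K → Fin K) (i : Fin K)
    (u : Fin K → unitInterval) (b : Fin K) :
    exp4sWeights K L (n + 1) (fun j => (appendRound s (h, i, u) j).obs) b =
      (1 - K * exp4sGamma K L) *
        (exp4sUpdate K L (exp4sWeights K L n fun j => (h j).obs) (i, s i, u (s i)) b /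
          ∑ e, exp4sUpdate K L (exp4sWeights K L n fun j => (h j).obs) (i, s i, u (s i)) e)
          + exp4sGamma K L := by
  have h1 : Fin.init (α := fun _ => Obs K) (fun j => (appendRound s (h, i, u) j).obs) =
      fun j => (h j).obs := by
    funext j
    simp [Fin.init, appendRound]
  have h2 : (appendRound s (h, i, u) (Fin.last n)).obs = (i, s i, u (s i)) := by
    simp [appendRound, Round.obs]
  simp only [exp4sWeights, h1, h2]

/-- The logarithm of the weight of `b` after `n` rounds. -/
def logWeight (K L : ℕ) (b : Fin K) (n : ℕ) (h : Fin n → Round K) : ℝ :=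
  Real.log (exp4sWeights K L n (fun j => (h j).obs) b)

theorem measurable_logWeight (b : Fin K) (n : ℕ) : Measurable (logWeight K L b n) :=
  Real.measurable_log.comp ((measurable_exp4sWeights K L n b).comp (measurable_pi_lambda _
    fun j => Round.measurable_obs.comp (measurable_pi_apply j)))

theorem integrable_reward {B : AgentBelief K T} (t : Fin T) (m : MeanSeq K T) (i : Fin K) :
    Integrable (fun u : Fin K → unitInterval => (u i : ℝ)) (B.rewardLaw t m) :=
  Integrable.of_bound (measurable_subtype_coe.comp (measurable_pi_apply i)).aestronglyMeasurable 1
    (ae_of_all _ fun u => by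
      rw [Real.norm_eq_abs, abs_of_nonneg (u i).2.1]
      exact (u i).2.2)

variable [NeZero K]

theorem logWeight_nonpos (b : Fin K) (n : ℕ) (h : Fin n → Round K) : logWeight K L b n h ≤ 0 :=
  Real.log_nonpos ((exp4sWeights_spec K L n _).1 b) (exp4sWeights_le_one K L n _ b)

theorem le_logWeight (hL : 1 ≤ L) (b : Fin K) (n : ℕ) (h : Fin n → Round K) :
    -Real.log (K * L) ≤ logWeight K L b n h := by
  have h1 := Real.log_le_log (exp4sGamma_pos (Nat.pos_of_ne_zero (NeZero.ne K)) hL)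
    (exp4sGamma_le_exp4sWeights K L hL n (fun j => (h j).obs) b)
  rwa [exp4sGamma, one_div, Real.log_inv] at h1

theorem abs_logWeight_le (hL : 1 ≤ L) (b : Fin K) (n : ℕ) (h : Fin n → Round K) :
    |logWeight K L b n h| ≤ Real.log (K * L) :=
  abs_le.2 ⟨le_logWeight hL b n h, (logWeight_nonpos b n h).trans
    (by linarith [(le_logWeight hL b n h).trans (logWeight_nonpos b n h)])⟩

/-- Under `i ∼ w` the loss estimate of `b` is unbiased, with mean `1 - μ_b`, and `1 / w i` has mean
`K`. The linear terms therefore combine to `η` times the regret, and the quadratic term costs `η²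
K`. -/
theorem le_integral_logWeight_step (hL : 2 ≤ L) (B : AgentBelief K T) (n : ℕ) (t : Fin T)
    (m : MeanSeq K T) (hm : ∀ a, ∫ u, (u a : ℝ) ∂(B.rewardLaw t m) = (m t a : ℝ))
    (h : Fin n → Round K) (b : Fin K) :
    logWeight K L b n h + (Real.log (1 - K * exp4sGamma K L) - exp4sEta K L ^ 2 * K)
      + exp4sEta K L * ∑ a, exp4sWeights K L n (fun j => (h j).obs) a * ((m t b : ℝ) - m t a) ≤
      ∫ p, logWeight K L b (n + 1) (appendRound id (h, p)) ∂(stepLaw (exp4s K L) B n t (m, h)) := by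
  have hK0 : 1 ≤ K := Nat.pos_of_ne_zero (NeZero.ne K)
  have hK0' : (0 : ℝ) < K := by exact_mod_cast hK0
  have hL' : (2 : ℝ) ≤ L := by exact_mod_cast hL
  set w := exp4sWeights K L n fun j => (h j).obs with hw
  set η := exp4sEta K L
  have hw0 : ∀ a, 0 < w a := fun a => (exp4sGamma_pos hK0 (by omega)).trans_le
    (exp4sGamma_le_exp4sWeights K L (by omega) n _ a)
  have hw1 : ∑ a, w a = 1 := (exp4sWeights_spec K L n _).2
  -- Here `Kγ = 1/L`, so `2 ≤ L` keeps the argument of the logarithm positive.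
  have hKγ : K * exp4sGamma K L < 1 := by
    unfold exp4sGamma
    rw [mul_one_div, div_lt_one (by positivity)]
    nlinarith
  have hf : Measurable fun p => logWeight K L b (n + 1) (appendRound id (h, p)) :=
    ((measurable_logWeight b (n + 1)).comp (measurable_appendRound id)).comp measurable_prodMk_left
  rw [integral_stepLaw _ _ _ _ _ _ hf (fun p => abs_logWeight_le (by omega) b _ _)]
  have hstep : ∀ i, Real.log (1 - K * exp4sGamma K L) + Real.log (w b)
        - η * (if b = i then (1 - (m t i : ℝ)) / w i else 0)
        + η * (1 - m t i) - η ^ 2 / w i ≤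
      ∫ u, logWeight K L b (n + 1) (appendRound id (h, i, u)) ∂(B.rewardLaw t m) := by
    intro i
    have hi : Integrable (fun u : Fin K → unitInterval => 1 - (u i : ℝ)) (B.rewardLaw t m) :=
      (integrable_const _).sub (integrable_reward t m i)
    have hmi : ∫ u, (1 - (u i : ℝ)) ∂(B.rewardLaw t m) = 1 - m t i := by
      rw [integral_sub (integrable_const _) (integrable_reward t m i), hm]
      simp
    set k := η - if b = i then η / w i else 0 with hk
    set c := Real.log (1 - K * exp4sGamma K L) + Real.log (w b) - η ^ 2 / w i with hc
    -- The lower bound is affine in the observed reward, so integrating it only replaces the reward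
    -- by its mean.
    have hform : ∀ y : ℝ, Real.log (1 - K * exp4sGamma K L) + Real.log (w b)
        - η * (if b = i then (1 - y) / w i else 0) + η * (1 - y) - η ^ 2 / w i =
        c + k * (1 - y) := by
      intro y
      rw [hk, hc]
      split_ifs <;> ring
    have h1 : ∫ u, (c + k * (1 - (u i : ℝ))) ∂(B.rewardLaw t m) = c + k * (1 - m t i) := by
      rw [integral_add (integrable_const _) (hi.const_mul _), integral_const_mul, hmi]
      simp
    rw [hform, ← h1]
    refine integral_mono ((integrable_const _).add (hi.const_mul _)) ?_ fun u => ?_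
    · exact Integrable.of_bound (hf.comp measurable_prodMk_left).aestronglyMeasurable _
        (ae_of_all _ fun u => abs_logWeight_le (by omega) b _ _)
    · have h2 := log_exp4s_step hKγ hw0 hw1 i b (u i)
      rw [hform] at h2
      refine h2.trans_eq ?_
      rw [logWeight, exp4sWeights_appendRound]
      rfl
  refine le_trans (le_of_eq ?_) (Finset.sum_le_sum fun i _ =>
    mul_le_mul_of_nonneg_left (hstep i) (measureReal_nonneg (μ := (exp4s K L).policy n _)))
  simp only [exp4s_policy_real, ← hw]
  have h3 : ∀ i, w i * (Real.log (1 - K * exp4sGamma K L) + Real.log (w b)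
        - η * (if b = i then (1 - (m t i : ℝ)) / w i else 0)
        + η * (1 - m t i) - η ^ 2 / w i) =
      w i * (Real.log (1 - K * exp4sGamma K L) + Real.log (w b)
        + η * (1 - m t b)) - η ^ 2 + η * (w i * ((m t b : ℝ) - m t i))
        - (if b = i then η * (1 - (m t i : ℝ)) else 0) := by
    intro i
    have := (hw0 i).ne'
    split_ifs with hb
    · field_simp
      ring
    · field_simp
      ring
  rw [Finset.sum_congr rfl fun i _ => h3 i, Finset.sum_sub_distrib, Finset.sum_add_distrib,
    Finset.sum_sub_distrib, ← Finset.sum_mul, hw1, ← Finset.mul_sum, Finset.sum_ite_eq]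
  simp only [Finset.sum_const, Finset.card_univ, Fintype.card_fin, nsmul_eq_mul, Finset.mem_univ,
    if_true, logWeight, ← hw]
  ring

/-- The expected logarithm of the weight of `b` after `n` rounds, given the means. -/
def expLogWeight (L : ℕ) (B : AgentBelief K T) (m : MeanSeq K T) (b : Fin K) (n : ℕ)
    (hn : n ≤ T) : ℝ :=
  ∫ h, logWeight K L b n h ∂(transcriptLaw (exp4s K L) B (compliant K T) 1 n hn m)

theorem integrable_logWeight (hL : 1 ≤ L) (b : Fin K) (n : ℕ) (μ : Measure (Fin n → Round K))
    [IsFiniteMeasure μ] : Integrable (logWeight K L b n) μ :=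
  Integrable.of_bound (measurable_logWeight b n).aestronglyMeasurable _
    (ae_of_all _ fun h => abs_logWeight_le hL b n h)

theorem expLogWeight_nonpos (B : AgentBelief K T) (m : MeanSeq K T) (b : Fin K) (n : ℕ)
    (hn : n ≤ T) : expLogWeight L B m b n hn ≤ 0 :=
  integral_nonpos fun h => logWeight_nonpos b n h

theorem le_expLogWeight (hL : 1 ≤ L) (B : AgentBelief K T) (m : MeanSeq K T) (b : Fin K) (n : ℕ)
    (hn : n ≤ T) : -Real.log (K * L) ≤ expLogWeight L B m b n hn := by
  have h := integral_mono (integrable_const (-Real.log (K * L)))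
    (integrable_logWeight hL b n (transcriptLaw (exp4s K L) B (compliant K T) 1 n hn m))
    fun h => le_logWeight hL b n h
  simpa [expLogWeight] using h

/-- The one-step bound is linear in the weights apart from the potential itself; averaging over the
past turns the weights into `recProb`. -/
theorem le_expLogWeight_succ (hL : 2 ≤ L) (B : AgentBelief K T) (n : ℕ) (hn : n + 1 ≤ T)
    (m : MeanSeq K T)
    (hm : ∀ a, ∫ u, (u a : ℝ) ∂(B.rewardLaw ⟨n, hn⟩ m) = (m ⟨n, hn⟩ a : ℝ)) (b : Fin K) :
    expLogWeight L B m b n (Nat.le_of_succ_le hn)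
      + (Real.log (1 - K * exp4sGamma K L) - exp4sEta K L ^ 2 * K)
      + exp4sEta K L * ∑ a, recProb (exp4s K L) B ⟨n, hn⟩ m a *
          ((m ⟨n, hn⟩ b : ℝ) - m ⟨n, hn⟩ a) ≤ expLogWeight L B m b (n + 1) hn := by
  set P := transcriptLaw (exp4s K L) B (compliant K T) 1 n (Nat.le_of_succ_le hn) m with hP
  have hwm : ∀ a, Measurable fun h : Fin n → Round K =>
      exp4sWeights K L n (fun j => (h j).obs) a := fun a =>
    (measurable_exp4sWeights K L n a).comp (measurable_pi_lambda _
      fun j => Round.measurable_obs.comp (measurable_pi_apply j))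
  have hwi : ∀ a, Integrable (fun h : Fin n → Round K =>
      exp4sWeights K L n (fun j => (h j).obs) a) P := fun a =>
    Integrable.of_bound (hwm a).aestronglyMeasurable 1 (ae_of_all _ fun h => by
      rw [Real.norm_eq_abs, abs_of_nonneg ((exp4sWeights_spec K L n _).1 a)]
      exact exp4sWeights_le_one K L n _ a)
  have hq : ∀ a, recProb (exp4s K L) B ⟨n, hn⟩ m a =
      ∫ h, exp4sWeights K L n (fun j => (h j).obs) a ∂P := by
    intro a
    rw [recProb_eq_integral]
    simp only [exp4s_policy_real]
    rfl
  have hsum : Integrable (fun h : Fin n → Round K => ∑ a, exp4sWeights K L n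
      (fun j => (h j).obs) a * ((m ⟨n, hn⟩ b : ℝ) - m ⟨n, hn⟩ a)) P :=
    integrable_finsetSum _ fun a _ => (hwi a).mul_const _
  have hlog : Integrable (fun h => logWeight K L b n h +
      (Real.log (1 - K * exp4sGamma K L) - exp4sEta K L ^ 2 * K)) P :=
    (integrable_logWeight (by omega) b n P).add (integrable_const _)
  have hleft : expLogWeight L B m b n (Nat.le_of_succ_le hn)
      + (Real.log (1 - K * exp4sGamma K L) - exp4sEta K L ^ 2 * K)
      + exp4sEta K L * ∑ a, recProb (exp4s K L) B ⟨n, hn⟩ m a *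
          ((m ⟨n, hn⟩ b : ℝ) - m ⟨n, hn⟩ a) =
      ∫ h, (logWeight K L b n h + (Real.log (1 - K * exp4sGamma K L) - exp4sEta K L ^ 2 * K)
      + exp4sEta K L * ∑ a, exp4sWeights K L n (fun j => (h j).obs) a *
          ((m ⟨n, hn⟩ b : ℝ) - m ⟨n, hn⟩ a)) ∂P := by
    rw [integral_add hlog (hsum.const_mul _), integral_add (integrable_logWeight (by omega) b n P)
      (integrable_const _), integral_const_mul, integral_finsetSum _ fun a _ =>
        (hwi a).mul_const _]
    simp only [integral_mul_const, hq, integral_const, probReal_univ, one_smul]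
    rfl
  rw [hleft, expLogWeight, integral_transcriptLaw_succ _ _ _ _ _ _ _ (measurable_logWeight b _)
    (fun h => abs_logWeight_le (by omega) b _ h)]
  have hmeas : Measurable fun h : Fin n → Round K =>
      ∫ p, logWeight K L b (n + 1) (appendRound (compliant K T ((1 : Equiv.Perm (Fin T)).symm
        ⟨n, hn⟩)) (h, p)) ∂(stepLaw (exp4s K L) B n ⟨n, hn⟩ (m, h)) := by
    have h1 : StronglyMeasurable fun q : (Fin n → Round K) × (Fin K × (Fin K → unitInterval)) =>
        logWeight K L b (n + 1) (appendRound (compliant K T ((1 : Equiv.Perm (Fin T)).symm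
        ⟨n, hn⟩)) q) :=
      ((measurable_logWeight b (n + 1)).comp (measurable_appendRound _)).stronglyMeasurable
    exact (h1.integral_kernel_prod_right' (κ := (stepLaw (exp4s K L) B n ⟨n, hn⟩).comap
      (fun h => (m, h)) measurable_prodMk_left)).measurable
  refine integral_mono (hlog.add (hsum.const_mul _)) ?_ fun h => le_integral_logWeight_step hL B n _ m hm h b
  refine Integrable.of_bound hmeas.aestronglyMeasurable (Real.log (K * L)) (ae_of_all _ fun h => ?_)
  refine (norm_integral_le_of_norm_le_const (ae_of_all _ fun p =>
    abs_logWeight_le (by omega) b _ _)).trans ?_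
  simp

end LogWeight

section WindowRegret

variable {K L T : ℕ} [NeZero K]

/-- Telescoping from an arbitrary start `s`. The length `l` is kept apart from the tuning parameter
`L` so that the induction leaves the algorithm fixed. -/
theorem le_expLogWeight_window (hL : 2 ≤ L) (B : AgentBelief K T) (m : MeanSeq K T)
    (hm : ∀ t a, ∫ u, (u a : ℝ) ∂(B.rewardLaw t m) = (m t a : ℝ)) (b : Fin K) (s l : ℕ)
    (h : s + l ≤ T) :
    expLogWeight L B m b s (by omega)
      + l * (Real.log (1 - K * exp4sGamma K L) - exp4sEta K L ^ 2 * K)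
      + exp4sEta K L * ∑ j : Fin l, ∑ a, recProb (exp4s K L) B ⟨s + j, by omega⟩ m a *
          ((m ⟨s + j, by omega⟩ b : ℝ) - m ⟨s + j, by omega⟩ a) ≤
      expLogWeight L B m b (s + l) h := by
  induction l with
  | zero => simp
  | succ l ih =>
    have h1 := ih (by omega)
    have h2 := le_expLogWeight_succ hL B (s + l) h m (hm _) b
    rw [Fin.sum_univ_castSucc]
    simp only [Fin.val_castSucc, Fin.val_last]
    have h3 : expLogWeight L B m b (s + (l + 1)) h = expLogWeight L B m b (s + l + 1) h := rfl
    rw [h3]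
    push_cast
    linarith

theorem one_le_mul_log {x : ℝ} (hx : 2 ≤ x) : 1 ≤ 2 * Real.log x := by
  have h := Real.log_le_log (by norm_num) hx
  linarith [Real.log_two_gt_d9]

/-- Expected regret of Exp4.S with parameter `L` over a window of length `L`, given the means. -/
theorem exp4s_window_regret (hL : 1 ≤ L) (B : AgentBelief K T) (m : MeanSeq K T)
    (hm : ∀ t a, ∫ u, (u a : ℝ) ∂(B.rewardLaw t m) = (m t a : ℝ)) (b : Fin K) (s : ℕ)
    (h : s + L ≤ T) :
    ∑ j : Fin L, ∑ a, recProb (exp4s K L) B ⟨s + j, by omega⟩ m a *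
        ((m ⟨s + j, by omega⟩ b : ℝ) - m ⟨s + j, by omega⟩ a) ≤
      L * (6 * √(K * Real.log (K * L) / L)) := by
  have hK0 : 1 ≤ K := Nat.pos_of_ne_zero (NeZero.ne K)
  have hK : (1 : ℝ) ≤ K := by exact_mod_cast hK0
  rcases hL.eq_or_lt with rfl | hL2
  -- For `L = 1`, `1 - Kγ = 0` and the potential argument fails. With one action the regret is zero;
  -- otherwise it is at most `1`, which is below the bound because `K log K ≥ 1`.
  · rcases hK0.eq_or_lt with rfl | hK2
    · simp [Subsingleton.elim b 0]
    · have hK2' : (2 : ℝ) ≤ K := by exact_mod_cast hK2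
      have hlog := one_le_mul_log hK2'
      have hsq : 1 ≤ √((K : ℝ) * Real.log (K * (1 : ℕ)) / (1 : ℕ)) := by
        rw [Real.one_le_sqrt]
        simp only [Nat.cast_one, mul_one, div_one]
        nlinarith
      have h1 : ∀ j : Fin 1, ∑ a, recProb (exp4s K 1) B ⟨s + j, by omega⟩ m a *
          ((m ⟨s + j, by omega⟩ b : ℝ) - m ⟨s + j, by omega⟩ a) ≤ 1 := by
        intro j
        rw [← sum_recProb (exp4s K 1) B ⟨s + j, by omega⟩ m]
        refine Finset.sum_le_sum fun a _ => mul_le_of_le_one_right (recProb_nonneg _ _ _ _ _) ?_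
        linarith [(m ⟨s + j, by omega⟩ b).2.2, (m ⟨s + j, by omega⟩ a).2.1]
      have h2 := h1 0
      rw [Fin.sum_univ_one, Nat.cast_one, one_mul]
      simp only [Nat.cast_one] at hsq
      linarith
  · have hL' : (2 : ℝ) ≤ L := by exact_mod_cast hL2
    have hL0 : (0 : ℝ) < L := by linarith
    have hK0' : (0 : ℝ) < K := by linarith
    have hwin := le_expLogWeight_window hL2 B m hm b s L h
    have hlow := le_expLogWeight hL B m b s (by omega)
    have hup := expLogWeight_nonpos (L := L) B m b (s + L) h
    set R := ∑ j : Fin L, ∑ a, recProb (exp4s K L) B ⟨s + j, by omega⟩ m a *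
        ((m ⟨s + j, by omega⟩ b : ℝ) - m ⟨s + j, by omega⟩ a)
    set ℓ := Real.log (K * L) with hℓ
    have hℓ1 : 1 ≤ 2 * ℓ := one_le_mul_log (by nlinarith)
    have hη2 : exp4sEta K L ^ 2 = ℓ / (K * L) :=
      Real.sq_sqrt (div_nonneg (by linarith) (by positivity))
    have hη : 0 < exp4sEta K L := Real.sqrt_pos.2 (div_pos (by linarith) (by positivity))
    have hη2' : L * (exp4sEta K L ^ 2 * K) = ℓ := by
      rw [hη2]; field_simp
    have hγ : K * exp4sGamma K L = 1 / L := by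
      rw [exp4sGamma]; field_simp
    -- From `log x ≥ 1 - 1/x` the value is at least `-L/(L-1)`, hence at least `-2` for `L ≥ 2`.
    have hlog : -2 ≤ L * Real.log (1 - K * exp4sGamma K L) := by
      rw [hγ]
      have h1 : (0 : ℝ) < 1 - 1 / L := by
        rw [sub_pos, div_lt_one hL0]; linarith
      have h2 := Real.one_sub_inv_le_log_of_pos h1
      have h3 : 1 - (1 - 1 / (L : ℝ))⁻¹ = -(1 / (L - 1)) := by
        have : (L : ℝ) - 1 ≠ 0 := by linarith
        field_simp
        ring
      rw [h3] at h2
      have h4 : (L : ℝ) * (1 / (L - 1)) ≤ 2 := by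
        rw [mul_one_div, div_le_iff₀ (by linarith)]
        linarith
      nlinarith [mul_le_mul_of_nonneg_left h2 hL0.le]
    -- The constant is `6 = 1 + 1 + 4`: `ℓ` for the range of the potential, `ℓ` for the quadratic
    -- term, and `2 ≤ 4ℓ` for mixing.
    have hηR : exp4sEta K L * R ≤ 6 * ℓ := by
      rw [mul_sub, hη2'] at hwin
      linarith
    have hη5 : exp4sEta K L * (L * √(K * ℓ / L)) = ℓ := by
      rw [exp4sEta, ← hℓ, mul_left_comm, ← Real.sqrt_mul (div_nonneg (by linarith) (by positivity))]
      have : ℓ / (K * L) * (K * ℓ / L) = (ℓ / L) ^ 2 := by field_simp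
      rw [this, Real.sqrt_sq (div_nonneg (by linarith) hL0.le)]
      field_simp
    refine le_of_mul_le_mul_left ?_ hη
    calc exp4sEta K L * R ≤ 6 * ℓ := hηR
      _ = _ := by linear_combination (-6) * hη5

end WindowRegret

/-! ### The law of the recommendation that an agent receives -/

section GameLaw

variable {K T : ℕ} (alg : Algorithm K) (B : AgentBelief K T)

theorem measurable_apply_fst {ι α : Type*} [Countable ι] [MeasurableSpace ι]
    [MeasurableSingletonClass ι] [MeasurableSpace α] :
    Measurable fun p : ι × (ι → α) => p.2 p.1 :=
  measurable_from_prod_countable_right fun i => measurable_pi_apply i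

theorem measurableSet_recommended (a : Fin K) : MeasurableSet (recommended (T := T) a) :=
  measurableSet_eq_fun (measurable_fst.comp (measurable_apply_fst.comp measurable_snd))
    measurable_const

instance (σ : Profile K T) (i : Fin T) : IsProbabilityMeasure (gameLaw alg B σ i) := by
  constructor
  have h : ∀ τ : Equiv.Perm (Fin T), Measurable fun p : MeanSeq K T × (Fin T → Round K) =>
      (p.1, τ i, p.2) := fun τ =>
    measurable_fst.prodMk (measurable_const.prodMk measurable_snd)
  simp only [gameLaw, Measure.coe_finsetSum, Finset.sum_apply, Measure.smul_apply, smul_eq_mul]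
  have h1 := B.arrival.tsum_coe
  rw [tsum_fintype] at h1
  rw [← h1]
  refine Finset.sum_congr rfl fun τ _ => ?_
  rw [Measure.map_apply (h τ) MeasurableSet.univ]
  simp

/-- Given the order and the means, the event has probability `recProb` in round `τ i`. Collecting
orders by the value of `τ i` leaves only the temporal marginal, so the rest of the arrival belief is
irrelevant. It serves with `g = 1` for the conditioning probability and with a mean reward for the
payoff. -/
theorem setIntegral_recommended (i : Fin T) (s : Fin K → Fin K) (a : Fin K)
    {g : Fin T → MeanSeq K T → ℝ} (hg : ∀ t, Measurable (g t)) (hg1 : ∀ t m, |g t m| ≤ 1) :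
    ∫ ω in recommended a, g ω.2.1 ω.1 ∂(gameLaw alg B (Function.update (compliant K T) i s) i) =
      ∑ t, (B.temporal i t).toReal * ∫ m, recProb alg B t m a * g t m ∂B.prior := by
  have hgm : Measurable fun ω : MeanSeq K T × Fin T × (Fin T → Round K) => g ω.2.1 ω.1 := by
    have : Measurable fun p : Fin T × MeanSeq K T => g p.1 p.2 :=
      measurable_from_prod_countable_right hg
    exact this.comp ((measurable_fst.comp measurable_snd).prodMk measurable_fst)
  set F : MeanSeq K T × Fin T × (Fin T → Round K) → ℝ :=
    (recommended a).indicator fun ω => g ω.2.1 ω.1 with hF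
  have hFm : Measurable F := hgm.indicator (measurableSet_recommended a)
  have hF1 : ∀ ω, ‖F ω‖ ≤ 1 := fun ω =>
    (norm_indicator_le_norm_self _ _).trans (hg1 _ _)
  have hpair : ∀ τ : Equiv.Perm (Fin T), Measurable fun p : MeanSeq K T × (Fin T → Round K) =>
      (p.1, τ i, p.2) := fun τ =>
    measurable_fst.prodMk (measurable_const.prodMk measurable_snd)
  have hterm : ∀ τ : Equiv.Perm (Fin T),
      ∫ ω, F ω ∂(B.prior ⊗ₘ transcriptLaw alg B (Function.update (compliant K T) i s) τ T
        le_rfl).map (fun p => (p.1, τ i, p.2)) =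
      ∫ m, recProb alg B (τ i) m a * g (τ i) m ∂B.prior := by
    intro τ
    have := Measure.isProbabilityMeasure_map (μ := B.prior ⊗ₘ transcriptLaw alg B
      (Function.update (compliant K T) i s) τ T le_rfl) (hpair τ).aemeasurable
    rw [integral_map (hpair τ).aemeasurable hFm.aestronglyMeasurable, Measure.integral_compProd]
    · refine integral_congr_ae (ae_of_all _ fun m => ?_)
      have h1 : (fun h : Fin T → Round K => F (m, τ i, h)) =
          {h | (h (τ i)).1 = a}.indicator fun _ => g (τ i) m := by
        funext h
        simp [hF, Set.indicator_apply, recommended]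
      have h2 : MeasurableSet {h : Fin T → Round K | (h (τ i)).1 = a} :=
        measurableSet_eq_fun (measurable_fst.comp (measurable_pi_apply (τ i))) measurable_const
      simp only [h1]
      refine (integral_indicator_const _ h2).trans ?_
      rw [transcriptLaw_update_real, smul_eq_mul]
    · exact Integrable.of_bound (hFm.comp (hpair τ)).aestronglyMeasurable 1
        (ae_of_all _ fun _ => hF1 _)
  rw [← integral_indicator (measurableSet_recommended a), ← hF, gameLaw,
    integral_finsetSum_measure]
  · simp only [integral_smul_measure, hterm, smul_eq_mul]
    have h1 : ∀ t, (B.temporal i t).toReal =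
        ∑ τ : Equiv.Perm (Fin T), if t = τ i then (B.arrival τ).toReal else 0 := by
      intro t
      rw [AgentBelief.temporal, PMF.map_apply, tsum_fintype, ENNReal.toReal_sum]
      · exact Finset.sum_congr rfl fun τ _ => by split_ifs <;> simp
      · intro τ _
        split_ifs
        · exact B.arrival.apply_ne_top τ
        · simp
    simp only [h1, Finset.sum_mul]
    rw [Finset.sum_comm]
    refine Finset.sum_congr rfl fun τ _ => ?_
    simp
  · intro τ _
    have := Measure.isProbabilityMeasure_map (μ := B.prior ⊗ₘ transcriptLaw alg B
      (Function.update (compliant K T) i s) τ T le_rfl) (hpair τ).aemeasurable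
    exact (Integrable.of_bound hFm.aestronglyMeasurable 1 (ae_of_all _ hF1)).smul_measure
      (B.arrival.apply_ne_top τ)

theorem gameLaw_real_recommended (i : Fin T) (s : Fin K → Fin K) (a : Fin K) :
    (gameLaw alg B (Function.update (compliant K T) i s) i).real (recommended a) =
      ∑ t, (B.temporal i t).toReal * ∫ m, recProb alg B t m a ∂B.prior := by
  have h := setIntegral_recommended alg B i s a (g := fun _ _ => 1) (fun _ => measurable_const)
    (by simp)
  simpa using h

/-- The denominator is free of `s`, so payoffs under different deviations can be subtracted over a
common denominator. -/
theorem condPayoff_update (i : Fin T) (s : Fin K → Fin K) (a : Fin K) :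
    condPayoff alg B (Function.update (compliant K T) i s) i a =
      (∑ t, (B.temporal i t).toReal * ∫ m, recProb alg B t m a * (m t (s a) : ℝ) ∂B.prior) /
        ∑ t, (B.temporal i t).toReal * ∫ m, recProb alg B t m a ∂B.prior := by
  have hm : ∀ t b, Measurable fun m : MeanSeq K T => (m t b : ℝ) := fun t b =>
    measurable_subtype_coe.comp ((measurable_pi_apply b).comp (measurable_pi_apply t))
  rw [condPayoff, ProbabilityTheory.cond, integral_smul_measure, smul_eq_mul,
    ← gameLaw_real_recommended alg B i s, ← setIntegral_recommended alg B i s a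
      (g := fun t m => (m t (s a) : ℝ)) (fun t => hm t _) ?_, ENNReal.toReal_inv,
    ← measureReal_def, div_eq_inv_mul]
  · congr 1
    refine setIntegral_congr_fun (measurableSet_recommended a) fun ω hω => ?_
    have hω' : (ω.2.2 ω.2.1).1 = a := hω
    simp [hω']
  · intro t m
    rw [abs_of_nonneg (m t (s a)).2.1]
    exact (m t (s a)).2.2

end GameLaw

/-! ### Temporal beliefs that are uniform on a window -/

theorem exists_window {T L : ℕ} {D : PMF (Fin T)} (hD : D ∈ uniformWindows T L) :
    ∃ s, ∃ hs : s + L ≤ T, ∀ g : Fin T → ℝ,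
      ∑ t, (D t).toReal * g t = (L : ℝ)⁻¹ * ∑ j : Fin L, g ⟨s + j, by omega⟩ := by
  obtain ⟨s, hs, hD⟩ := hD
  refine ⟨s, hs, fun g => ?_⟩
  have h1 : ∀ t, (D t).toReal * g t =
      if s ≤ (t : ℕ) ∧ (t : ℕ) < s + L then (L : ℝ)⁻¹ * g t else 0 := by
    intro t
    rw [hD]
    split_ifs <;> simp
  rw [Finset.sum_congr rfl fun t _ => h1 t, ← Finset.sum_filter, Finset.mul_sum]
  refine (Finset.sum_bij (fun (j : Fin L) _ => (⟨s + j, by omega⟩ : Fin T)) ?_ ?_ ?_ ?_).symm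
  · intro j _
    simp
  · intro j _ k _ h
    simp only [Fin.mk.injEq, Nat.add_left_cancel_iff] at h
    exact Fin.ext h
  · intro t ht
    simp only [Finset.mem_filter, Finset.mem_univ, true_and] at ht
    exact ⟨⟨t - s, by omega⟩, Finset.mem_univ _, Fin.ext (by simp; omega)⟩
  · intro j _
    rfl

theorem abs_sub_le_of_slowly {K T : ℕ} {ρ : ℝ} {m : MeanSeq K T}
    (hm : ∀ (t : ℕ) (h : t + 1 < T),
      ‖fun a : Fin K => (m ⟨t + 1, h⟩ a : ℝ) - (m ⟨t, Nat.lt_of_succ_lt h⟩ a : ℝ)‖ ≤ ρ)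
    (a : Fin K) (t t' : Fin T) :
    |(m t a : ℝ) - m t' a| ≤ ρ * |((t : ℕ) : ℝ) - (t' : ℕ)| := by
  have key : ∀ (n s : ℕ) (h : s + n < T),
      |(m ⟨s + n, h⟩ a : ℝ) - m ⟨s, by omega⟩ a| ≤ ρ * n := by
    intro n s h
    induction n with
    | zero => simp
    | succ n ih =>
      have h1 := ih (by omega)
      have h2 := (norm_le_pi_norm (fun a : Fin K =>
        (m ⟨s + n + 1, h⟩ a : ℝ) - (m ⟨s + n, by omega⟩ a : ℝ)) a).trans (hm (s + n) h)
      rw [Real.norm_eq_abs] at h2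
      have h3 := abs_sub_le (m ⟨s + n + 1, h⟩ a : ℝ) (m ⟨s + n, by omega⟩ a) (m ⟨s, by omega⟩ a)
      push_cast
      change |(m ⟨s + n + 1, h⟩ a : ℝ) - m ⟨s, by omega⟩ a| ≤ _
      linarith
  have key' : ∀ t t' : Fin T, t' ≤ t →
      |(m t a : ℝ) - m t' a| ≤ ρ * |((t : ℕ) : ℝ) - (t' : ℕ)| := by
    intro t t' h
    obtain ⟨n, hn⟩ := Nat.exists_eq_add_of_le (Fin.le_def.1 h)
    have h1 := key n t' (by omega)
    have h2 : (⟨t' + n, by omega⟩ : Fin T) = t := Fin.ext hn.symm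
    rw [h2] at h1
    rw [hn]
    simpa using h1
  rcases le_total t' t with h | h
  · exact key' t t' h
  · rw [abs_sub_comm, abs_sub_comm (((t : ℕ) : ℝ))]
    exact key' t' t h

/-! ### The equilibrium guarantee -/

theorem rate_nonneg {C : ℝ} (hC : 0 ≤ C) (K L : ℕ) : 0 ≤ rate C K L := by
  unfold rate; positivity

/-- The second summand of `rate` is slack in this argument: the regret is bounded directly in
expectation given the means, without a concentration step. -/
theorem le_rate (C : ℝ) (K L : ℕ) : C * √(K * Real.log (K * L) / L) ≤ rate C K L := by
  unfold rate
  linarith [Real.sqrt_nonneg (2 * Real.log (2 * K) / L)]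

/-- The sign of `ρ` is not assumed. If `L ≥ 2` there are two rounds, and a norm at a typical point
of the prior is at most `ρ`; if `L = 1` the product is zero. -/
theorem drift_nonneg {K T L : ℕ} (hL : 1 ≤ L) (hLT : L ≤ T) {B : AgentBelief K T}
    {ρ : ℝ} (h : B.SlowlyMoving ρ) : 0 ≤ ρ * (L - 1) := by
  rcases hL.eq_or_lt with rfl | hL2
  · simp
  · obtain ⟨m, hm⟩ := h.exists
    have h1 : (1 : ℝ) ≤ L := by exact_mod_cast hL
    exact mul_nonneg ((norm_nonneg _).trans (hm 0 (by omega))) (by linarith)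

/-! ### Gain and recommendation probability over one window. -/

section Window

variable {K T L : ℕ} {B : AgentBelief K T} {ρ r α Δ : ℝ} {s : ℕ}

theorem integrable_recProb (alg : Algorithm K) (t : Fin T) (a : Fin K) :
    Integrable (fun m => recProb alg B t m a) B.prior :=
  Integrable.of_bound (measurable_recProb alg B t a).aestronglyMeasurable 1
    (ae_of_all _ fun m => by
      rw [Real.norm_eq_abs, abs_of_nonneg (recProb_nonneg _ _ _ _ _)]
      exact recProb_le_one _ _ _ _ _)

theorem integrable_recProb_mul (alg : Algorithm K) (t : Fin T) (a b : Fin K) :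
    Integrable (fun m => recProb alg B t m a * (m t b : ℝ)) B.prior :=
  Integrable.of_bound ((measurable_recProb alg B t a).mul (measurable_subtype_coe.comp
    ((measurable_pi_apply b).comp (measurable_pi_apply t)))).aestronglyMeasurable 1
    (ae_of_all _ fun m => by
      rw [Real.norm_eq_abs, abs_of_nonneg (mul_nonneg (recProb_nonneg _ _ _ _ _) (m t b).2.1)]
      exact mul_le_one₀ (recProb_le_one _ _ _ _ _) (m t b).2.1 (m t b).2.2)

/-- The expected gain from replacing the recommendation `a` by `b` over a window. -/
theorem window_gain_le (alg : Algorithm K) (hL : 1 ≤ L) (hs : s + L ≤ T)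
    (hslow : B.SlowlyMoving ρ)
    (hr : ∀ᵐ m ∂B.prior, ∀ b, ∑ j : Fin L, ∑ a, recProb alg B ⟨s + j, by omega⟩ m a *
        ((m ⟨s + j, by omega⟩ b : ℝ) - m ⟨s + j, by omega⟩ a) ≤ L * r) (a b : Fin K) :
    (L : ℝ)⁻¹ * ∑ j : Fin L, ∫ m, recProb alg B ⟨s + j, by omega⟩ m a *
        (m ⟨s + j, by omega⟩ b : ℝ) ∂B.prior -
      (L : ℝ)⁻¹ * ∑ j : Fin L, ∫ m, recProb alg B ⟨s + j, by omega⟩ m a *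
        (m ⟨s + j, by omega⟩ a : ℝ) ∂B.prior ≤ r + 2 * ρ * ((L : ℝ) ^ 2 - 1) / (3 * L) := by
  have hL0 : (0 : ℝ) < L := by exact_mod_cast hL
  have hi : ∀ (j : Fin L) (e : Fin K), Integrable (fun m => recProb alg B ⟨s + j, by omega⟩ m a *
      (m ⟨s + j, by omega⟩ e : ℝ)) B.prior := fun j e => integrable_recProb_mul alg _ a e
  rw [← mul_sub, ← Finset.sum_sub_distrib, inv_mul_le_iff₀ hL0]
  simp only [← integral_sub (hi _ b) (hi _ a), ← mul_sub]
  have hi' : ∀ j : Fin L, Integrable (fun m => recProb alg B ⟨s + j, by omega⟩ m a *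
      ((m ⟨s + j, by omega⟩ b : ℝ) - m ⟨s + j, by omega⟩ a)) B.prior := fun j => by
    simp only [mul_sub]
    exact (hi j b).sub (hi j a)
  rw [← integral_finsetSum _ fun j _ => hi' j]
  have h := integral_mono_ae (integrable_finsetSum Finset.univ fun j _ => hi' j)
    (integrable_const (μ := B.prior) (L * (r + 2 * ρ * ((L : ℝ) ^ 2 - 1) / (3 * L)))) (by
      filter_upwards [hslow, hr] with m hm hrm
      refine sum_mul_sub_le_of_regret hL
        (x := fun j e => (m ⟨s + j, by omega⟩ e : ℝ))
        (p := fun j e => recProb alg B ⟨s + j, by omega⟩ m e) ?_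
        (fun j e => recProb_nonneg _ _ _ _ _) (fun j => sum_recProb _ _ _ _) hrm a b
      intro e j k
      simpa using abs_sub_le_of_slowly hm e ⟨s + j, by omega⟩ ⟨s + k, by omega⟩)
  simpa using h

/-- Every explorable action is recommended with a probability bounded from below. -/
theorem le_window_prob (alg : Algorithm K) (hL : 1 ≤ L) (hs : s + L ≤ T) {D : PMF (Fin T)}
    (hD : ∀ g : Fin T → ℝ,
      ∑ t, (D t).toReal * g t = (L : ℝ)⁻¹ * ∑ j : Fin L, g ⟨s + j, by omega⟩)
    (hslow : B.SlowlyMoving ρ) (hρ : 0 ≤ ρ * (L - 1)) (hexp : B.Explorable D α Δ)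
    (hpos : 0 < Δ - r - ρ * (L - 1)) (hpos' : 0 < Δ - ρ * (L - 1))
    (hr : ∀ᵐ m ∂B.prior, ∀ b, ∑ j : Fin L, ∑ a, recProb alg B ⟨s + j, by omega⟩ m a *
        ((m ⟨s + j, by omega⟩ b : ℝ) - m ⟨s + j, by omega⟩ a) ≤ L * r) (a : Fin K) :
    α * ((Δ - r - ρ * (L - 1)) / (Δ - ρ * (L - 1))) ≤
      (L : ℝ)⁻¹ * ∑ j : Fin L, ∫ m, recProb alg B ⟨s + j, by omega⟩ m a ∂B.prior := by
  have hL0 : (0 : ℝ) < L := by exact_mod_cast hL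
  set c := (Δ - r - ρ * (L - 1)) / (Δ - ρ * (L - 1)) with hc
  have hc0 : 0 < c := div_pos hpos hpos'
  set Q : MeanSeq K T → ℝ := fun m => ∑ j : Fin L, recProb alg B ⟨s + j, by omega⟩ m a with hQ
  have hQi : Integrable Q B.prior := integrable_finsetSum _ fun j _ => integrable_recProb alg _ a
  have hQ0 : ∀ m, 0 ≤ Q m := fun m => Finset.sum_nonneg fun j _ => recProb_nonneg _ _ _ _ _
  rw [← integral_finsetSum _ fun j _ => integrable_recProb alg _ a, ← div_eq_inv_mul,
    le_div_iff₀ hL0]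
  -- Markov's inequality at the level `L * c`, which `Q` reaches almost surely on the event that `a`
  -- has gap at least `Δ`.
  have hmarkov := mul_meas_ge_le_integral_of_nonneg (ae_of_all _ hQ0) hQi (L * c)
  have hsub : B.prior.real {m | (Δ : EReal) ≤ gap m D a} ≤ B.prior.real {m | L * c ≤ Q m} := by
    refine ENNReal.toReal_mono (measure_ne_top _ _) (measure_mono_ae ?_)
    filter_upwards [hslow, hr] with m hm hrm hgap
    refine le_sum_of_regret_of_gap hL hρ
        (x := fun j e => (m ⟨s + j, by omega⟩ e : ℝ))
        (p := fun j e => recProb alg B ⟨s + j, by omega⟩ m e) ?_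
        (fun j e => recProb_nonneg _ _ _ _ _) (fun j => sum_recProb _ _ _ _) a (hrm a) ?_ hpos'
    · intro e j k
      simpa using abs_sub_le_of_slowly hm e ⟨s + j, by omega⟩ ⟨s + k, by omega⟩
    · intro b hb
      have h1 : (Δ : EReal) ≤ ((∑ t, (D t).toReal * ((m t a : ℝ) - (m t b : ℝ)) : ℝ) : EReal) :=
        le_trans hgap (iInf₂_le b hb)
      rw [EReal.coe_le_coe_iff, hD fun t => (m t a : ℝ) - (m t b : ℝ)] at h1
      rwa [← le_inv_mul_iff₀ hL0]
  have h2 := (hexp a).trans hsub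
  have h3 := mul_le_mul_of_nonneg_left h2 (mul_pos hL0 hc0).le
  calc α * c * L = L * c * α := by ring
    _ ≤ _ := h3.trans hmarkov

end Window

theorem exp4s_implementsICBNE {K : ℕ} [NeZero K] {T L : ℕ} (hL : 1 ≤ L) (hLT : L ≤ T)
    {α Δ ρ : ℝ} (hα : 0 < α) (hgap : 0 < effectiveGap 6 K L Δ ρ) {B : Fin T → AgentBelief K T}
    (hexp : ∀ i, (B i).Explorable ((B i).temporal i) α Δ) (hslow : ∀ i, (B i).SlowlyMoving ρ)
    (hD : ∀ i, (B i).temporal i ∈ uniformWindows T L) :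
    ImplementsICBNE (exp4s K L) B fun _ => errorTerm 6 K L α Δ ρ := by
  intro i σ' a _
  obtain ⟨s, hs, hw⟩ := exists_window (hD i)
  have hL1 : (1 : ℝ) ≤ L := by exact_mod_cast hL
  have hρ := drift_nonneg hL hLT (hslow i)
  have hrate := rate_nonneg (by norm_num : (0 : ℝ) ≤ 6) K L
  have hgap' : 0 < Δ - rate 6 K L - ρ * (L - 1) := hgap
  have hpos' : 0 < Δ - ρ * (L - 1) := by linarith
  have hr : ∀ᵐ m ∂(B i).prior, ∀ b, ∑ j : Fin L, ∑ a, recProb (exp4s K L) (B i)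
      ⟨s + j, by omega⟩ m a * ((m ⟨s + j, by omega⟩ b : ℝ) - m ⟨s + j, by omega⟩ a) ≤
        L * rate 6 K L := by
    filter_upwards [(B i).mean_reward] with m hm b
    exact (exp4s_window_regret hL (B i) m hm b s hs).trans
      (mul_le_mul_of_nonneg_left (le_rate _ _ _) (by linarith))
  have hgain := window_gain_le (exp4s K L) hL hs (hslow i) hr a (σ' a)
  have hprob := le_window_prob (exp4s K L) hL hs hw (hslow i) hρ (hexp i) hgap' hpos' hr a
  -- Compliance is written as the deviation to `id`, so one formula covers both payoffs.
  have hid : compliant K T = Function.update (compliant K T) i id :=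
    (Function.update_eq_self i _).symm
  have hcomp := condPayoff_update (exp4s K L) (B i) i id a
  rw [← hid] at hcomp
  rw [hcomp, condPayoff_update, ge_iff_le, sub_le_iff_le_add', ← sub_le_iff_le_add, ← sub_div,
    hw, hw, hw]
  have hP := lt_of_lt_of_le (mul_pos hα (div_pos hgap' hpos')) hprob
  rw [div_le_iff₀ hP]
  refine hgain.trans ?_
  set N := rate 6 K L + 2 * ρ * ((L : ℝ) ^ 2 - 1) / (3 * L) with hN
  have hN0 : 0 ≤ N := by
    -- Factoring out `ρ(L-1)` matters: only this product, not `ρ`, is known to be nonnegative.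
    have h1 : 2 * ρ * ((L : ℝ) ^ 2 - 1) = 2 * (ρ * (L - 1)) * (L + 1) := by ring
    rw [hN, h1]
    positivity
  -- The error is exactly the gain bound `N` divided by the lower bound on the probability of the
  -- recommendation.
  have herr : errorTerm 6 K L α Δ ρ * (α * ((Δ - rate 6 K L - ρ * (L - 1)) /
      (Δ - ρ * (L - 1)))) = N := by
    rw [errorTerm, ← hN, effectiveGap]
    field_simp
  have herr0 : 0 ≤ errorTerm 6 K L α Δ ρ :=
    div_nonneg (mul_nonneg hN0 hpos'.le) (mul_pos hα hgap).le
  calc N = _ := herr.symm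
    _ ≤ _ := mul_le_mul_of_nonneg_left hprob herr0

/-! ### Growing windows -/

theorem tendsto_rate (C : ℝ) (K : ℕ) [NeZero K] : Tendsto (rate C K) atTop (nhds 0) := by
  have hK : (0 : ℝ) < K := by exact_mod_cast Nat.pos_of_ne_zero (NeZero.ne K)
  have hcast : Tendsto (fun L : ℕ => (K : ℝ) * L) atTop atTop :=
    tendsto_natCast_atTop_atTop.const_mul_atTop hK
  have hlog : Tendsto (fun L : ℕ => Real.log (K * L) / (K * L)) atTop (nhds 0) :=
    Real.isLittleO_log_id_atTop.tendsto_div_nhds_zero.comp hcast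
  have h1 : Tendsto (fun L : ℕ => (K : ℝ) * Real.log (K * L) / L) atTop (nhds 0) := by
    have h := hlog.const_mul ((K : ℝ) ^ 2)
    rw [mul_zero] at h
    refine h.congr fun L => ?_
    rcases Nat.eq_zero_or_pos L with rfl | hL
    · simp
    · have : (0 : ℝ) < L := by exact_mod_cast hL
      field_simp
  have h2 : Tendsto (fun L : ℕ => 2 * Real.log (2 * K) / (L : ℝ)) atTop (nhds 0) :=
    tendsto_const_nhds.div_atTop tendsto_natCast_atTop_atTop
  have h3 := ((Real.continuous_sqrt.tendsto 0).comp h1).const_mul C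
  have h4 := ((Real.continuous_sqrt.tendsto 0).comp h2).const_mul 2
  have h5 := h3.add h4
  simp only [Real.sqrt_zero, mul_zero, add_zero] at h5
  exact h5

theorem tendsto_effectiveGap_errorTerm (C : ℝ) (K : ℕ) [NeZero K] {α Δ : ℝ} (hα : 0 < α)
    (hΔ : 0 < Δ) {L : ℕ → ℕ} {ρ : ℕ → ℝ} (hL : Tendsto L atTop atTop)
    (hρ : ρ =o[atTop] (fun T => 1 / (L T : ℝ))) :
    Tendsto (fun T => effectiveGap C K (L T) Δ (ρ T)) atTop (nhds Δ) ∧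
      Tendsto (fun T => errorTerm C K (L T) α Δ (ρ T)) atTop (nhds 0) := by
  have hcast : Tendsto (fun T => (L T : ℝ)) atTop atTop := tendsto_natCast_atTop_atTop.comp hL
  have hrate : Tendsto (fun T => rate C K (L T)) atTop (nhds 0) := (tendsto_rate C K).comp hL
  have hρL : Tendsto (fun T => ρ T * L T) atTop (nhds 0) := by
    refine hρ.tendsto_div_nhds_zero.congr fun T => ?_
    simp
  have hinv : Tendsto (fun T => (L T : ℝ)⁻¹) atTop (nhds 0) := tendsto_inv_atTop_zero.comp hcast
  have hdrift : Tendsto (fun T => ρ T * ((L T : ℝ) - 1)) atTop (nhds 0) := by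
    have h := hρL.mul ((tendsto_const_nhds (x := (1 : ℝ))).sub hinv)
    rw [zero_mul] at h
    refine h.congr' ?_
    filter_upwards [hcast.eventually_gt_atTop 0] with T hT
    field_simp
  -- The term equals `(2/3) · ρ(L-1) · (1 + 1/L)`, so it vanishes together with `ρ(L-1)`.
  have hdrift2 : Tendsto (fun T => 2 * ρ T * ((L T : ℝ) ^ 2 - 1) / (3 * L T)) atTop (nhds 0) := by
    have h := (hdrift.mul ((tendsto_const_nhds (x := (1 : ℝ))).add hinv)).const_mul (2 / 3)
    rw [zero_mul, mul_zero] at h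
    refine h.congr' ?_
    filter_upwards [hcast.eventually_gt_atTop 0] with T hT
    field_simp
    ring
  have heff : Tendsto (fun T => effectiveGap C K (L T) Δ (ρ T)) atTop (nhds Δ) := by
    have h := ((tendsto_const_nhds (x := Δ)).sub hrate).sub hdrift
    simp only [sub_zero] at h
    exact h
  refine ⟨heff, ?_⟩
  have h := ((hrate.add hdrift2).mul ((tendsto_const_nhds (x := Δ)).sub hdrift)).div
    (heff.const_mul α) (mul_pos hα hΔ).ne'
  simp only [add_zero, zero_mul, zero_div] at h
  exact h

end IncentivizedExploration

end

open IncentivizedExploration in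
theorem mainTheorem4 :
    ∃ C : ℝ, 0 < C ∧
      -- the equilibrium guarantee, for every horizon and every window length
      (∀ (K : ℕ) [NeZero K] (T L : ℕ), 1 ≤ L → L ≤ T →
        ∀ α Δ ρ : ℝ, 0 < α → 0 < Δ → 0 < effectiveGap C K L Δ ρ →
        ∀ B : Fin T → AgentBelief K T,
          (∀ i, (B i).Explorable ((B i).temporal i) α Δ) →
          (∀ i, (B i).SlowlyMoving ρ) →
          (∀ i, (B i).temporal i ∈ uniformWindows T L) →
          ImplementsICBNE (exp4s K L) B fun _ => errorTerm C K L α Δ ρ) ∧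
      -- the error vanishes for growing windows if the drift is `o(1/L)`
      (∀ (K : ℕ) [NeZero K] (α Δ : ℝ), 0 < α → 0 < Δ →
        ∀ (L : ℕ → ℕ) (ρ : ℕ → ℝ), Filter.Tendsto L Filter.atTop Filter.atTop →
          ρ =o[Filter.atTop] (fun T => 1 / (L T : ℝ)) →
          (∀ᶠ T in Filter.atTop, 0 < effectiveGap C K (L T) Δ (ρ T)) ∧
          Filter.Tendsto (fun T => errorTerm C K (L T) α Δ (ρ T)) Filter.atTop (nhds 0)) := by
  refine ⟨6, by norm_num, ?_, ?_⟩
  · intro K _ T L hL hLT α Δ ρ hα _ hgap B hexp hslow hD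
    exact exp4s_implementsICBNE hL hLT hα hgap hexp hslow hD
  · intro K _ α Δ hα hΔ L ρ hL hρ
    obtain ⟨h1, h2⟩ := tendsto_effectiveGap_errorTerm 6 K hα hΔ hL hρ
    exact ⟨h1.eventually_const_lt hΔ, h2⟩
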